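/- **Setting.** Fix sets of codes, method calls $m=o.m(\vec x)$, thread-local states $\sigma$, operation identifiers and locks; a reduction relation $c\lightning(m,c')$ ("$m$ is a next method call of $c$, with remaining code $c'$"); a predicate $\mathrm{fin}(c)$ ("$c$ can finish without a further method call"); a prefix-closed set of *allowed* logs, where a log is a list of operations $\langle m,\sigma,\sigma',id\rangle$; and a set $\mathrm{locks}(m)$ of abstract locks for every method call. Code is deterministic: each $c$ has at most one next pair $(m,c')$, and none if $\mathrm{fin}(c)$. For logs, $\ell\preceq\ell'$ means that for every $s$, if $\ell\cdot s$ is allowed then $\ell'\cdot s$ is allowed. Write $o\blacktriangleleft o'$ if $\ell\cdot o\cdot o'\preceq\ell\cdot o'\cdot o$ for all $\ell$; $m,n$ commute if $o\blacktriangleleft o'$ and $o'\blacktriangleleft o$ for all operations $o$ of $m$ and $o'$ of $n$. Boosting lock rule: if $m,n$ do not commute, then $\mathrm{locks}(m)\cap\mathrm{locks}(n)\neq\emptyset$. **Push/Pull.** A configuration consists of $N$ threads $\{p,\sigma,L\}$ (with $p=\mathtt{tx}\,c$ while the transaction runs and $p=\mathtt{skip}$ once it has committed) and a shared log $G$. Entries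 of a local log $L$ are flagged unpushed, pushed or pulled (unpushed and pushed entries also store the code before the operation; the non-pulled ones are the thread's *own*); entries of $G$ are flagged uncommitted or committed. Initially thread $i$ is $\{\mathtt{tx}\,c_i,\sigma_i,\emptyset\}$ and $G=\emptyset$. A running thread can make the following transitions. * *Step*, forward: if $c\lightning(m,c')$, $o=\langle m,\sigma,\sigma',id\rangle$, $L\cdot o$ is allowed and $id$ occurs in no log of the configuration, go to $\{\mathtt{tx}\,c',\sigma',L\cdot o\}$ with $o$ unpushed. *Step*, backward: undo this when the last entry of $L$ is unpushed. * *Push* an unpushed $o$ of $L=L_1\cdot o\cdot L_2$, appending it to $G$ as uncommitted, if (i) $o\blacktriangleleft o'$ for all unpushed $o'\in L_1$, (ii) $o'\blacktriangleleft o$ for all uncommitted $o'\in G$ that are not pushed entries of $L_1\cdot L_2$, (iii) $G\cdot o$ is allowed. * *Unpush* a pushed $o$ of $L=L_1\cdot o\cdot L_2$, where $G=G_1\cdot o\cdot G_2$ with $o$ uncommitted, leaving $G_1\cdot G_2$, if $o'\blacktriangleleft o$ for all pushed $o'\in L_2$ and $G_1\cdot G_2$ is allowed. * *Pull* $o\in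 G$ with $o\notin L$, going to $L\cdot o$, if $L\cdot o$ is allowed and $o'\blacktriangleleft o$ for all own $o'\in L$. *Unpull* a pulled $o$ of $L_1\cdot o\cdot L_2$ if $L_1\cdot L_2$ is allowed. * *Commit*, if $\mathrm{fin}(c)$, $L$ has no unpushed entries and all pulled entries of $L$ are committed in $G$: the thread becomes $\{\mathtt{skip},\sigma,\emptyset\}$ and its operations are marked committed in $G$. **Miner.** The miner makes Push/Pull transitions. In addition its transactions start and acquire locks; a transaction must have started before it acquires locks or makes Push/Pull transitions; a lock is held by at most one transaction at a time; a forward Step executing $m$ requires the transaction to hold $\mathrm{locks}(m)$; locks are kept until the transaction commits (which releases them) or has been rolled back so that it has no own operations left (when it may release them). The miner records an event log $E$ of the start, lock, operation and commit events of each transaction. A relation $\sqsubseteq$ on transactions is *emitted by the miner* (on $c_i,\sigma_i$) if for some run from the initial configuration in which all transactions have committed, $$\tau'\sqsubseteq\tau\iff(\tau',\mathsf{commit})<_E(\tau,\mathsf{commit})\ \wedge\ \exists\,\ell.\ (\tau',\mathsf{lock}\ \ell)\in E\wedge(\tau,\mathsf{lock}\ \ell)\in E.$$ **Validator.** $\leadsto_V^{\sqsubseteq}$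 is Push/Pull without condition (ii) of Push, and with the additional premise of Step (forward and backward) for $\tau$ that all $\tau'\sqsubseteq\tau$ have finished, i.e. their programs are $\mathtt{skip}$. It has the same initial configuration. **Atomic machine.** A configuration consists of pairs $(p_i,\sigma_i)$ and a log $l$, initially $(\mathtt{tx}\,c_i,\sigma_i)$ and $l=\emptyset$. In one step of $\xrightarrow{A}$ some $(\mathtt{tx}\,c,\sigma)$ is run to completion: for $c\lightning(m_1,c^1),\ c^1\lightning(m_2,c^2),\dots,\ c^{k-1}\lightning(m_k,c^k)$ with $\mathrm{fin}(c^k)$ ($k\ge 0$, $c^0=c$, $\sigma^0=\sigma$), operations $\langle m_j,\sigma^{j-1},\sigma^j,id_j\rangle$ with fresh identifiers are appended one after the other to $l$, which stays allowed after each, and the pair becomes $(\mathtt{skip},\sigma^k)$. **Lemma (Validator serializability).** Let $N\ge 0$ and let $c_i,\sigma_i$ ($1\le i\le N$) be given. For every happens-before relation $\sqsubseteq$ emitted by the miner, the validator $\leadsto_V^{\sqsubseteq}$ simulates the atomic machine $\xrightarrow{A}$. That is, there is a relation $R$ between validator and atomic configurations such that 1. $R$ relates the initial configurations; 2. if $(\mathbf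 T,G)\mathrel R(\mathbf A,l)$ and $(\mathbf T,G)\leadsto_V^{\sqsubseteq}(\mathbf T',G')$, then there is $(\mathbf A',l')$ with $(\mathbf A,l)\xrightarrow{A}{}^{*}(\mathbf A',l')$ and $(\mathbf T',G')\mathrel R(\mathbf A',l')$; 3. if $(\mathbf T,G)\mathrel R(\mathbf A,l)$, then the list of committed operations of $G$ is $\preceq l$, each transaction that has finished in $\mathbf T$ with local state $\sigma$ is $(\mathtt{skip},\sigma)$ in $\mathbf A$, and each other transaction $i$ is $(\mathtt{tx}\,c_i,\sigma_i)$ in $\mathbf A$. -/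

import Mathlib

namespace PushPull

universe u₁ u₂ u₃ u₄ u₅

/-- An operation record: the method call (with its arguments), the thread-local states before and
after the call (these carry arguments and return values), and an operation identifier. -/
structure Op (Method : Type u₂) (Stack : Type u₃) (Id : Type u₄) where
  meth : Method
  pre : Stack
  post : Stack
  id : Id

/-- The parameters of the Push/Pull model: `step c m c'` says that `m` is a next reachable method
call of the code `c`, with remaining code `c'`; `fin c` says that `c` can reduce to `skip` without
encountering a method call; `allowed` is the sequential specification of the shared object, as a
set of logs; `locks m` is the set of abstract locks that are associated with `m`. -/
structure Model (Code : Type u₁) (Method : Type u₂) (Stack : Type u₃) (Id : Type u₄)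
    (Lock : Type u₅) where
  step : Code → Method → Code → Prop
  fin : Code → Prop
  allowed : List (Op Method Stack Id) → Prop
  locks : Method → Set Lock

/-- The program of a thread: a transaction that is still running with remaining code `c`,
or `skip` once the transaction has committed. -/
inductive Prog (Code : Type u₁) where
  | tx (c : Code) : Prog Code
  | skip : Prog Code

/-- Flags of local log entries: not pushed, pushed (both with the code before the operation), and
pulled from the shared log. -/
inductive LFlag (Code : Type u₁) where
  | npshd (c : Code) : LFlag Code
  | pshd (c : Code) : LFlag Code
  | pld : LFlag Code

/-- Flags of shared log entries: uncommitted and committed. -/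
inductive GFlag where
  | gUCmt : GFlag
  | gCmt : GFlag

section Logs

variable {Code : Type u₁} {Method : Type u₂} {Stack : Type u₃} {Id : Type u₄}

abbrev LLog (Code : Type u₁) (Method : Type u₂) (Stack : Type u₃) (Id : Type u₄) :=
  List (Op Method Stack Id × LFlag Code)

abbrev GLog (Method : Type u₂) (Stack : Type u₃) (Id : Type u₄) :=
  List (Op Method Stack Id × GFlag)

def LLog.ops (L : LLog Code Method Stack Id) : List (Op Method Stack Id) :=
  L.map Prod.fst

def LLog.unpushed (L : LLog Code Method Stack Id) : List (Op Method Stack Id) :=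
  L.filterMap fun e => match e.2 with
    | .npshd _ => some e.1
    | _ => none

def LLog.pushed (L : LLog Code Method Stack Id) : List (Op Method Stack Id) :=
  L.filterMap fun e => match e.2 with
    | .pshd _ => some e.1
    | _ => none

def LLog.pulled (L : LLog Code Method Stack Id) : List (Op Method Stack Id) :=
  L.filterMap fun e => match e.2 with
    | .pld => some e.1
    | _ => none

/-- The operations that the thread performed itself, pushed or not. -/
def LLog.own (L : LLog Code Method Stack Id) : List (Op Method Stack Id) :=
  L.filterMap fun e => match e.2 with
    | .pld => none
    | _ => some e.1

def GLog.ops (G : GLog Method Stack Id) : List (Op Method Stack Id) :=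
  G.map Prod.fst

def GLog.committed (G : GLog Method Stack Id) : List (Op Method Stack Id) :=
  G.filterMap fun e => match e.2 with
    | .gCmt => some e.1
    | .gUCmt => none

def GLog.uncommitted (G : GLog Method Stack Id) : List (Op Method Stack Id) :=
  G.filterMap fun e => match e.2 with
    | .gCmt => none
    | .gUCmt => some e.1

open Classical in
/-- Mark the operations of the list `os` as committed. -/
noncomputable def GLog.commit (G : GLog Method Stack Id) (os : List (Op Method Stack Id)) :
    GLog Method Stack Id :=
  G.map fun e => if e.1 ∈ os then (e.1, GFlag.gCmt) else e

end Logs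

/-- A thread `{p, σ, L}`: program, thread-local state, local log. -/
structure Thread (Code : Type u₁) (Method : Type u₂) (Stack : Type u₃) (Id : Type u₄) where
  prog : Prog Code
  stack : Stack
  log : LLog Code Method Stack Id

/-- A configuration of the Push/Pull model with `N` threads and a shared log. -/
structure Config (N : ℕ) (Code : Type u₁) (Method : Type u₂) (Stack : Type u₃) (Id : Type u₄) where
  thr : Fin N → Thread Code Method Stack Id
  glob : GLog Method Stack Id

/-- A configuration of the atomic machine: a list of programs with local states, and a log. -/
structure AConfig (N : ℕ) (Code : Type u₁) (Method : Type u₂) (Stack : Type u₃) (Id : Type u₄) where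
  thr : Fin N → Prog Code × Stack
  log : List (Op Method Stack Id)

/-- Names of the rules; `app` and `unapp` are the forward and backward local steps. -/
inductive Act (Method : Type u₂) where
  | app (m : Method) : Act Method
  | unapp : Act Method
  | push : Act Method
  | unpush : Act Method
  | pull : Act Method
  | unpull : Act Method
  | cmt : Act Method

section Machines

variable {N : ℕ} {Code : Type u₁} {Method : Type u₂} {Stack : Type u₃} {Id : Type u₄}
  {Lock : Type u₅}

/-- An operation identifier is fresh if it occurs in no local log and not in the shared log. -/
def Config.Fresh (C : Config N Code Method Stack Id) (id : Id) : Prop :=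
  (∀ i, ∀ o ∈ (C.thr i).log.ops, o.id ≠ id) ∧ ∀ o ∈ C.glob.ops, o.id ≠ id

/-- Replace the `i`-th thread. -/
def Config.setThr (C : Config N Code Method Stack Id) (i : Fin N)
    (t : Thread Code Method Stack Id) : Config N Code Method Stack Id :=
  ⟨Function.update C.thr i t, C.glob⟩

/-- Initial configuration: every thread is about to run its transaction; all logs are empty. -/
def Config.init (c : Fin N → Code) (σ : Fin N → Stack) : Config N Code Method Stack Id :=
  ⟨fun i => ⟨.tx (c i), σ i, []⟩, []⟩

def AConfig.init (c : Fin N → Code) (σ : Fin N → Stack) : AConfig N Code Method Stack Id :=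
  ⟨fun i => (.tx (c i), σ i), []⟩

namespace Model

variable (M : Model Code Method Stack Id Lock)

/-- The log relation `l ≼ l'`: whatever is observable (allowed) after `l` is so after `l'`. -/
def LogLe (l l' : List (Op Method Stack Id)) : Prop :=
  ∀ s, M.allowed (l ++ s) → M.allowed (l' ++ s)

/-- `LogLe` is the greatest relation that preserves `allowed` and is stable under appending an
operation. -/
theorem logLe_iff_coinductive (l l' : List (Op Method Stack Id)) :
    M.LogLe l l' ↔ ∃ R : List (Op Method Stack Id) → List (Op Method Stack Id) → Prop, R l l' ∧
      ∀ a b, R a b → (M.allowed a → M.allowed b) ∧ ∀ o, R (a ++ [o]) (b ++ [o]) := by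
  constructor
  · intro h
    refine ⟨M.LogLe, h, fun a b hab => ⟨fun ha => ?_, fun o s hs => ?_⟩⟩
    · simpa using hab [] (by simpa using ha)
    · simpa using hab (o :: s) (by simpa using hs)
  · rintro ⟨R, hR, hstep⟩ s
    induction s generalizing l l' with
    | nil => simpa using (hstep l l' hR).1
    | cons o s ih =>
      intro hs
      have := ih (l ++ [o]) (l' ++ [o]) ((hstep l l' hR).2 o) (by simpa using hs)
      simpa using this

/-- The mover relation `o₁ ◁ o₂`: in every context, `o₁ · o₂` can be replaced by `o₂ · o₁`. -/
def Mover (o₁ o₂ : Op Method Stack Id) : Prop :=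
  ∀ l, M.LogLe (l ++ [o₁, o₂]) (l ++ [o₂, o₁])

/-- Two method calls commute if all operations that invoke them can be swapped both ways. -/
def Commute (m n : Method) : Prop :=
  ∀ o₁ o₂ : Op Method Stack Id, o₁.meth = m → o₂.meth = n → M.Mover o₁ o₂ ∧ M.Mover o₂ o₁

/-- The sequential specification is closed under prefixes. -/
def PrefixClosed : Prop :=
  ∀ l o, M.allowed (l ++ [o]) → M.allowed l

/-- Code is deterministic: at most one next method call and continuation, and code that has a next
method call cannot also finish. -/
def Deterministic : Prop :=
  (∀ c m m' c' c'', M.step c m c' → M.step c m' c'' → m = m' ∧ c' = c'') ∧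
    ∀ c m c', M.fin c → ¬ M.step c m c'

/-- The boosting lock rule: method calls that do not commute share an abstract lock. -/
def BoostingRule : Prop :=
  ∀ m n, ¬ M.Commute m n → (M.locks m ∩ M.locks n).Nonempty

/-- The local steps `⇀fwd` (rule App) and `⇀bwd` (rule Unapp) of a thread. -/
inductive LocalStep (fresh : Id → Prop) :
    Act Method → Thread Code Method Stack Id → Thread Code Method Stack Id → Prop
  | app (c₁ c₂ : Code) (m : Method) (σ₁ σ₂ : Stack) (id : Id) (L : LLog Code Method Stack Id)
      (hstep : M.step c₁ m c₂)
      (hallow : M.allowed (L.ops ++ [⟨m, σ₁, σ₂, id⟩]))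
      (hfresh : fresh id) :
      LocalStep fresh (.app m) ⟨.tx c₁, σ₁, L⟩
        ⟨.tx c₂, σ₂, L ++ [(⟨m, σ₁, σ₂, id⟩, .npshd c₁)]⟩
  | unapp (c₁ c₂ : Code) (m : Method) (σ₁ σ₂ : Stack) (id : Id) (L : LLog Code Method Stack Id) :
      LocalStep fresh .unapp ⟨.tx c₂, σ₂, L ++ [(⟨m, σ₁, σ₂, id⟩, .npshd c₁)]⟩
        ⟨.tx c₁, σ₁, L⟩

/-- The rules of the Push/Pull model for thread `i`, with two places left open: an extra premise
`stepGuard C i` of rule Step, and the premise `pushGuard C L₁ L₂ o` of rule Push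
about the uncommitted operations of other transactions. -/
inductive Trans
    (stepGuard : Config N Code Method Stack Id → Fin N → Prop)
    (pushGuard : Config N Code Method Stack Id → LLog Code Method Stack Id →
      LLog Code Method Stack Id → Op Method Stack Id → Prop)
    (i : Fin N) :
    Act Method → Config N Code Method Stack Id → Config N Code Method Stack Id → Prop
  | step (C : Config N Code Method Stack Id) (a : Act Method) (t : Thread Code Method Stack Id)
      (hguard : stepGuard C i)
      (hlocal : M.LocalStep C.Fresh a (C.thr i) t) :
      Trans stepGuard pushGuard i a C (C.setThr i t)
  | push (C : Config N Code Method Stack Id) (c c' : Code) (σ : Stack)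
      (L₁ L₂ : LLog Code Method Stack Id) (o : Op Method Stack Id)
      (hthr : C.thr i = ⟨.tx c, σ, L₁ ++ (o, .npshd c') :: L₂⟩)
      (hlocal : ∀ o' ∈ L₁.unpushed, M.Mover o o')
      (hguard : pushGuard C L₁ L₂ o)
      (hallow : M.allowed (C.glob.ops ++ [o])) :
      Trans stepGuard pushGuard i .push C
        ⟨Function.update C.thr i ⟨.tx c, σ, L₁ ++ (o, .pshd c') :: L₂⟩, C.glob ++ [(o, .gUCmt)]⟩
  | unpush (C : Config N Code Method Stack Id) (c c' : Code) (σ : Stack)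
      (L₁ L₂ : LLog Code Method Stack Id) (G₁ G₂ : GLog Method Stack Id) (o : Op Method Stack Id)
      (hthr : C.thr i = ⟨.tx c, σ, L₁ ++ (o, .pshd c') :: L₂⟩)
      (hglob : C.glob = G₁ ++ (o, .gUCmt) :: G₂)
      (hlocal : ∀ o' ∈ L₂.pushed, M.Mover o' o)
      (hallow : M.allowed (GLog.ops (G₁ ++ G₂))) :
      Trans stepGuard pushGuard i .unpush C
        ⟨Function.update C.thr i ⟨.tx c, σ, L₁ ++ (o, .npshd c') :: L₂⟩, G₁ ++ G₂⟩
  | pull (C : Config N Code Method Stack Id) (c : Code) (σ : Stack)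
      (L : LLog Code Method Stack Id) (o : Op Method Stack Id)
      (hthr : C.thr i = ⟨.tx c, σ, L⟩)
      (hglob : o ∈ C.glob.ops)
      (hnew : o ∉ L.ops)
      (hallow : M.allowed (L.ops ++ [o]))
      (hlocal : ∀ o' ∈ L.own, M.Mover o' o) :
      Trans stepGuard pushGuard i .pull C (C.setThr i ⟨.tx c, σ, L ++ [(o, .pld)]⟩)
  | unpull (C : Config N Code Method Stack Id) (c : Code) (σ : Stack)
      (L₁ L₂ : LLog Code Method Stack Id) (o : Op Method Stack Id)
      (hthr : C.thr i = ⟨.tx c, σ, L₁ ++ (o, .pld) :: L₂⟩)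
      (hallow : M.allowed (LLog.ops (L₁ ++ L₂))) :
      Trans stepGuard pushGuard i .unpull C (C.setThr i ⟨.tx c, σ, L₁ ++ L₂⟩)
  | cmt (C : Config N Code Method Stack Id) (c : Code) (σ : Stack)
      (L : LLog Code Method Stack Id)
      (hthr : C.thr i = ⟨.tx c, σ, L⟩)
      (hfin : M.fin c)
      (hpushed : L.unpushed = [])
      (hpulled : ∀ o ∈ L.pulled, o ∈ C.glob.committed) :
      Trans stepGuard pushGuard i .cmt C
        ⟨Function.update C.thr i ⟨.skip, σ, []⟩, C.glob.commit L.own⟩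

/-- Transitions of the Push/Pull model: rule Step has no extra premise, and rule Push requires the
uncommitted operations of other transactions in the shared log to move across the pushed one. -/
def PPTrans (i : Fin N) :
    Act Method → Config N Code Method Stack Id → Config N Code Method Stack Id → Prop :=
  M.Trans (fun _ _ => True)
    (fun C L₁ L₂ o => ∀ o' ∈ C.glob.uncommitted, o' ∉ LLog.pushed (L₁ ++ L₂) → M.Mover o' o) i

/-- Transitions of the validator for `hb`: rule Step waits until all `hb`-predecessors have
finished, and rule Push has no premise about other transactions. -/
def ValidatorStep (hb : Fin N → Fin N → Prop) (C C' : Config N Code Method Stack Id) : Prop :=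
  ∃ i a, M.Trans (fun C i => ∀ j, hb j i → (C.thr j).prog = .skip) (fun _ _ _ _ => True) i a C C'

/-- Serial execution of the body of a transaction, from code, local state and log to local state
and log. -/
inductive BigStep : Code → Stack → List (Op Method Stack Id) →
    Stack → List (Op Method Stack Id) → Prop
  | fin (c : Code) (σ : Stack) (l : List (Op Method Stack Id)) (hfin : M.fin c) :
      BigStep c σ l σ l
  | step (c c' : Code) (m : Method) (σ σ' σ'' : Stack) (id : Id) (l l'' : List (Op Method Stack Id))
      (hstep : M.step c m c')
      (hfresh : ∀ o ∈ l, o.id ≠ id)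
      (hallow : M.allowed (l ++ [⟨m, σ, σ', id⟩]))
      (hrest : BigStep c' σ' (l ++ [⟨m, σ, σ', id⟩]) σ'' l'') :
      BigStep c σ l σ'' l''

/-- A step of the atomic machine: some transaction runs to completion. -/
def AtomicStep (A A' : AConfig N Code Method Stack Id) : Prop :=
  ∃ (i : Fin N) (c : Code) (σ σ' : Stack) (l' : List (Op Method Stack Id)),
    A.thr i = (.tx c, σ) ∧ M.BigStep c σ A.log σ' l' ∧
      A' = ⟨Function.update A.thr i (.skip, σ'), l'⟩

end Model

/-- The events that a miner records for a transaction. -/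
inductive EventKind (Method : Type u₂) (Lock : Type u₅) where
  | start : EventKind Method Lock
  | lock (k : Lock) : EventKind Method Lock
  | op (m : Method) : EventKind Method Lock
  | commit : EventKind Method Lock

abbrev EventLog (N : ℕ) (Method : Type u₂) (Lock : Type u₅) :=
  List (Fin N × EventKind Method Lock)

/-- The happens-before relation of an event log: `j` commits before `i`, and some lock is acquired
by both. -/
def EventLog.HappensBefore (E : EventLog N Method Lock) (j i : Fin N) : Prop :=
  List.Sublist [(j, EventKind.commit), (i, EventKind.commit)] E ∧
    ∃ k, (j, EventKind.lock k) ∈ E ∧ (i, EventKind.lock k) ∈ E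

/-- A configuration of the miner: a Push/Pull configuration, the locks held by each transaction,
and the event log. -/
structure MConfig (N : ℕ) (Code : Type u₁) (Method : Type u₂) (Stack : Type u₃) (Id : Type u₄)
    (Lock : Type u₅) where
  conf : Config N Code Method Stack Id
  held : Fin N → Set Lock
  events : EventLog N Method Lock

namespace Model

variable (M : Model Code Method Stack Id Lock)

/-- Transitions of the miner. It makes Push/Pull transitions only; abstract locks are mutually
exclusive, the locks of a method call have to be held when it is executed, and they are kept until
the transaction commits or has been rolled back completely. -/
inductive MinerStep :
    MConfig N Code Method Stack Id Lock → MConfig N Code Method Stack Id Lock → Prop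
  | start (K : MConfig N Code Method Stack Id Lock) (i : Fin N)
      (hnew : (i, EventKind.start) ∉ K.events) :
      MinerStep K ⟨K.conf, K.held, K.events ++ [(i, .start)]⟩
  | lock (K : MConfig N Code Method Stack Id Lock) (i : Fin N) (k : Lock)
      (hstarted : (i, EventKind.start) ∈ K.events)
      (hrunning : (K.conf.thr i).prog ≠ .skip)
      (hfree : ∀ j, j ≠ i → k ∉ K.held j) :
      MinerStep K
        ⟨K.conf, Function.update K.held i (insert k (K.held i)), K.events ++ [(i, .lock k)]⟩
  | op (K : MConfig N Code Method Stack Id Lock) (i : Fin N) (m : Method)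
      (C' : Config N Code Method Stack Id)
      (hstarted : (i, EventKind.start) ∈ K.events)
      (hlocks : M.locks m ⊆ K.held i)
      (htrans : M.PPTrans i (.app m) K.conf C') :
      MinerStep K ⟨C', K.held, K.events ++ [(i, .op m)]⟩
  | silent (K : MConfig N Code Method Stack Id Lock) (i : Fin N) (a : Act Method)
      (C' : Config N Code Method Stack Id)
      (hstarted : (i, EventKind.start) ∈ K.events)
      (hact : a = .unapp ∨ a = .push ∨ a = .unpush ∨ a = .pull ∨ a = .unpull)
      (htrans : M.PPTrans i a K.conf C') :
      MinerStep K ⟨C', K.held, K.events⟩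
  | commit (K : MConfig N Code Method Stack Id Lock) (i : Fin N)
      (C' : Config N Code Method Stack Id)
      (hstarted : (i, EventKind.start) ∈ K.events)
      (htrans : M.PPTrans i .cmt K.conf C') :
      MinerStep K ⟨C', Function.update K.held i ∅, K.events ++ [(i, .commit)]⟩
  | release (K : MConfig N Code Method Stack Id Lock) (i : Fin N)
      (hempty : (K.conf.thr i).log.own = []) :
      MinerStep K ⟨K.conf, Function.update K.held i ∅, K.events⟩

/-- `hb` is the happens-before relation of the event log of a complete miner run (one in which all
transactions have committed) on the transactions `c` with initial local states `σ`. -/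
def MinerEmits (c : Fin N → Code) (σ : Fin N → Stack) (hb : Fin N → Fin N → Prop) : Prop :=
  ∃ K : MConfig N Code Method Stack Id Lock,
    Relation.ReflTransGen M.MinerStep ⟨Config.init c σ, fun _ => ∅, []⟩ K ∧
      (∀ i, (K.conf.thr i).prog = .skip) ∧
      ∀ j i, hb j i ↔ K.events.HappensBefore j i

/-- What related configurations have to agree on: the committed part of the shared log is below
the atomic log, committed transactions have finished in the atomic machine with the same local
state, and all others have not started there. -/
def Agree (c : Fin N → Code) (σ : Fin N → Stack)
    (C : Config N Code Method Stack Id) (A : AConfig N Code Method Stack Id) : Prop :=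
  M.LogLe C.glob.committed A.log ∧
    ∀ i, ((C.thr i).prog = .skip → A.thr i = (.skip, (C.thr i).stack)) ∧
      ((C.thr i).prog ≠ .skip → A.thr i = (.tx (c i), σ i))

end Model

end Machines

/-- The system `(X, stepX, x₀)` simulates `(Y, stepY, y₀)` up to `agree`: some relation within
`agree` contains the initial states, and every step of `X` from related states is matched
by finitely many (possibly no) steps of `Y` that lead to related states. -/
def Simulates {X Y : Type*} (stepX : X → X → Prop) (stepY : Y → Y → Prop) (agree : X → Y → Prop)
    (x₀ : X) (y₀ : Y) : Prop :=
  ∃ R : X → Y → Prop, R x₀ y₀ ∧ (∀ x y, R x y → agree x y) ∧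
    ∀ x y x', R x y → stepX x x' → ∃ y', Relation.ReflTransGen stepY y y' ∧ R x' y'

end PushPull

namespace PushPull

universe u₁ u₂ u₃ u₄ u₅

/-! ### Relative order of two list elements, with `[a, b]` being a sublist read as "`a` occurs
before `b`". -/

section Lists

variable {α : Type*}

/-! The atomic machine runs a transaction at the moment the validator commits it; every other
validator step is matched by no step. The atomic log thus lists the own operations of the committed
transactions in commit order, each block in the order of its local log. A log is below every
permutation of it whose inversions are movers (`logLe_of_inversions`), so it suffices to control the
inversions between the shared log and the atomic log (`SimInv`).

When a transaction commits, an inversion has one of three sources. It may be an old one. It may join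
an own operation to an operation that stands later in the shared log but was committed earlier; this
pair was shown to be a mover when the later operation was committed. Or both operations belong to
the committing transaction, and then the premises of Push and Unpush about the local log give the
mover (`LogOK.mover_of_sublist`). To keep the second case going, operations of other running
transactions must move across the newly committed ones.

That is where the miner enters. Code is deterministic, so a transaction that commits has performed
every method call reachable from its code (`Run.exists_of_calls`) and has recorded all their locks.
If two transactions can reach non-commuting calls, the boosting rule gives a lock recorded by both,
and the order of their commit events puts them in `hb`. Hence unrelated transactions commute, a
property of their code alone that holds in every validator run (`MinerEmits.unrelatedCommute`). In
the validator, a thread with own operations has only finished predecessors, so two threads with own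
operations are unrelated and their operations commute (`ThreadInv.mover`). This replaces the dropped
premise of Push.

The atomic run is allowed because the shared log is allowed and lies below the new atomic log
followed by the remaining uncommitted operations (`SimInv.logLe`); prefix closure does the rest
(`Run.bigStep`). -/

theorem pair_sublist_append {a b : α} {X Y : List α} :
    List.Sublist [a, b] (X ++ Y) ↔
      List.Sublist [a, b] X ∨ (a ∈ X ∧ b ∈ Y) ∨ List.Sublist [a, b] Y := by
  induction X with
  | nil => simp
  | cons x X ih =>
    simp only [List.cons_append, List.cons_sublist_cons', ih, List.singleton_sublist,
      List.mem_append, List.mem_cons]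
    tauto

theorem not_pair_sublist_swap {a b : α} {X : List α} (hX : X.Nodup)
    (h : List.Sublist [a, b] X) : ¬ List.Sublist [b, a] X := by
  induction X with
  | nil => simp at h
  | cons x X ih =>
    rw [List.nodup_cons] at hX
    simp only [List.cons_sublist_cons', List.singleton_sublist] at h ⊢
    rintro (h' | ⟨rfl, h'⟩) <;> rcases h with h | ⟨rfl, h⟩
    · exact ih hX.2 h h'
    · exact hX.1 (h'.subset (by simp))
    · exact hX.1 (h.subset (by simp))
    · exact hX.1 h

theorem pair_sublist_total {a b : α} {X : List α} (hab : a ≠ b) (ha : a ∈ X) (hb : b ∈ X) :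
    List.Sublist [a, b] X ∨ List.Sublist [b, a] X := by
  obtain ⟨X₁, X₂, rfl⟩ := List.append_of_mem ha
  have h : b ∈ X₁ ∨ b ∈ X₂ := by simpa [hab.symm] using hb
  simp only [pair_sublist_append, List.cons_sublist_cons', List.singleton_sublist, List.mem_cons]
  tauto

end Lists

/-! ### Membership and projections of local and shared logs. -/

section Logs

variable {Code : Type u₁} {Method : Type u₂} {Stack : Type u₃} {Id : Type u₄}

/-- The own operations of a local log, each with the code before the operation. -/
def LLog.ownCode (L : LLog Code Method Stack Id) : List (Op Method Stack Id × Code) :=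
  L.filterMap fun e => match e.2 with
    | .npshd c => some (e.1, c)
    | .pshd c => some (e.1, c)
    | .pld => none

theorem LLog.own_eq (L : LLog Code Method Stack Id) : L.own = L.ownCode.map Prod.fst := by
  rw [LLog.own, LLog.ownCode, List.map_filterMap]
  congr 1
  funext ⟨o, f⟩
  cases f <;> rfl

theorem LLog.ownCode_append (L₁ L₂ : LLog Code Method Stack Id) :
    LLog.ownCode (L₁ ++ L₂) = LLog.ownCode L₁ ++ LLog.ownCode L₂ :=
  List.filterMap_append ..

theorem LLog.ownCode_npshd (o : Op Method Stack Id) (c : Code) (L : LLog Code Method Stack Id) :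
    LLog.ownCode ((o, .npshd c) :: L) = (o, c) :: LLog.ownCode L := rfl

theorem LLog.ownCode_pshd (o : Op Method Stack Id) (c : Code) (L : LLog Code Method Stack Id) :
    LLog.ownCode ((o, .pshd c) :: L) = (o, c) :: LLog.ownCode L := rfl

theorem LLog.ownCode_pld (o : Op Method Stack Id) (L : LLog Code Method Stack Id) :
    LLog.ownCode ((o, .pld) :: L) = LLog.ownCode L := rfl

theorem LLog.ownCode_nil : LLog.ownCode ([] : LLog Code Method Stack Id) = [] := rfl

theorem LLog.mem_pushed {L : LLog Code Method Stack Id} {o : Op Method Stack Id} :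
    o ∈ L.pushed ↔ ∃ c, (o, LFlag.pshd c) ∈ L := by
  simp only [LLog.pushed, List.mem_filterMap]
  constructor
  · rintro ⟨⟨o', f⟩, h, h'⟩
    cases f <;> simp at h'
    exact ⟨_, h' ▸ h⟩
  · rintro ⟨c, h⟩
    exact ⟨_, h, rfl⟩

theorem LLog.mem_unpushed {L : LLog Code Method Stack Id} {o : Op Method Stack Id} :
    o ∈ L.unpushed ↔ ∃ c, (o, LFlag.npshd c) ∈ L := by
  simp only [LLog.unpushed, List.mem_filterMap]
  constructor
  · rintro ⟨⟨o', f⟩, h, h'⟩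
    cases f <;> simp at h'
    exact ⟨_, h' ▸ h⟩
  · rintro ⟨c, h⟩
    exact ⟨_, h, rfl⟩

theorem LLog.mem_own {L : LLog Code Method Stack Id} {o : Op Method Stack Id} :
    o ∈ L.own ↔ (∃ c, (o, LFlag.npshd c) ∈ L) ∨ ∃ c, (o, LFlag.pshd c) ∈ L := by
  simp only [LLog.own, List.mem_filterMap]
  constructor
  · rintro ⟨⟨o', f⟩, h, h'⟩
    cases f <;> simp at h' <;> subst h'
    exacts [Or.inl ⟨_, h⟩, Or.inr ⟨_, h⟩]
  · rintro (⟨c, h⟩ | ⟨c, h⟩) <;> exact ⟨_, h, rfl⟩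

theorem LLog.own_append (L₁ L₂ : LLog Code Method Stack Id) :
    LLog.own (L₁ ++ L₂) = LLog.own L₁ ++ LLog.own L₂ :=
  List.filterMap_append ..

theorem LLog.own_npshd (o : Op Method Stack Id) (c : Code) (L : LLog Code Method Stack Id) :
    LLog.own ((o, .npshd c) :: L) = o :: LLog.own L := rfl

theorem LLog.own_pshd (o : Op Method Stack Id) (c : Code) (L : LLog Code Method Stack Id) :
    LLog.own ((o, .pshd c) :: L) = o :: LLog.own L := rfl

theorem LLog.own_pld (o : Op Method Stack Id) (L : LLog Code Method Stack Id) :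
    LLog.own ((o, .pld) :: L) = LLog.own L := rfl

theorem LLog.own_nil : LLog.own ([] : LLog Code Method Stack Id) = [] := rfl

theorem LLog.mem_own_of_pushed {L : LLog Code Method Stack Id} {o : Op Method Stack Id}
    (h : o ∈ L.pushed) : o ∈ L.own :=
  LLog.mem_own.2 (Or.inr (LLog.mem_pushed.1 h))

theorem LLog.mem_own_of_unpushed {L : LLog Code Method Stack Id} {o : Op Method Stack Id}
    (h : o ∈ L.unpushed) : o ∈ L.own :=
  LLog.mem_own.2 (Or.inl (LLog.mem_unpushed.1 h))

theorem LLog.mem_ops_of_mem_own {L : LLog Code Method Stack Id} {o : Op Method Stack Id}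
    (h : o ∈ L.own) : o ∈ L.ops := by
  rcases LLog.mem_own.1 h with ⟨c, h⟩ | ⟨c, h⟩ <;> exact List.mem_map_of_mem h

theorem GLog.mem_committed {G : GLog Method Stack Id} {o : Op Method Stack Id} :
    o ∈ G.committed ↔ (o, GFlag.gCmt) ∈ G := by
  simp only [GLog.committed, List.mem_filterMap]
  constructor
  · rintro ⟨⟨o', f⟩, h, h'⟩
    cases f <;> simp at h'
    exact h' ▸ h
  · exact fun h => ⟨_, h, rfl⟩

theorem GLog.mem_uncommitted {G : GLog Method Stack Id} {o : Op Method Stack Id} :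
    o ∈ G.uncommitted ↔ (o, GFlag.gUCmt) ∈ G := by
  simp only [GLog.uncommitted, List.mem_filterMap]
  constructor
  · rintro ⟨⟨o', f⟩, h, h'⟩
    cases f <;> simp at h'
    exact h' ▸ h
  · exact fun h => ⟨_, h, rfl⟩

theorem GLog.mem_ops {G : GLog Method Stack Id} {o : Op Method Stack Id} :
    o ∈ G.ops ↔ o ∈ G.committed ∨ o ∈ G.uncommitted := by
  rw [GLog.mem_committed, GLog.mem_uncommitted, GLog.ops, List.mem_map]
  constructor
  · rintro ⟨⟨o, f⟩, h, rfl⟩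
    cases f
    exacts [Or.inr h, Or.inl h]
  · rintro (h | h) <;> exact ⟨_, h, rfl⟩

theorem GLog.ops_append (G₁ G₂ : GLog Method Stack Id) :
    GLog.ops (G₁ ++ G₂) = GLog.ops G₁ ++ GLog.ops G₂ :=
  List.map_append ..

theorem GLog.uncommitted_append (G₁ G₂ : GLog Method Stack Id) :
    GLog.uncommitted (G₁ ++ G₂) = GLog.uncommitted G₁ ++ GLog.uncommitted G₂ :=
  List.filterMap_append ..

theorem GLog.committed_sublist (G : GLog Method Stack Id) :
    List.Sublist G.committed G.ops := by
  induction G with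
  | nil => exact List.Sublist.refl _
  | cons e G ih =>
    obtain ⟨o, f⟩ := e
    cases f
    exacts [ih.cons o, ih.cons_cons o]

theorem GLog.uncommitted_sublist (G : GLog Method Stack Id) :
    List.Sublist G.uncommitted G.ops := by
  induction G with
  | nil => exact List.Sublist.refl _
  | cons e G ih =>
    obtain ⟨o, f⟩ := e
    cases f
    exacts [ih.cons_cons o, ih.cons o]

theorem GLog.committed_perm_uncommitted (G : GLog Method Stack Id) :
    G.ops.Perm (G.committed ++ G.uncommitted) := by
  induction G with
  | nil => exact List.Perm.refl _
  | cons e G ih =>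
    obtain ⟨o, f⟩ := e
    cases f
    exacts [(ih.cons o).trans List.perm_middle.symm, ih.cons o]

theorem GLog.ops_commit (G : GLog Method Stack Id) (os : List (Op Method Stack Id)) :
    (G.commit os).ops = G.ops := by
  simp only [GLog.ops, GLog.commit, List.map_map]
  refine List.map_congr_left fun e _ => ?_
  simp only [Function.comp_apply]
  split_ifs <;> rfl

theorem GLog.mem_committed_commit {G : GLog Method Stack Id} {os : List (Op Method Stack Id)}
    {o : Op Method Stack Id} :
    o ∈ (G.commit os).committed ↔ o ∈ G.committed ∨ (o ∈ os ∧ o ∈ G.uncommitted) := by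
  simp only [GLog.mem_committed, GLog.mem_uncommitted, GLog.commit, List.mem_map]
  constructor
  · rintro ⟨⟨o', f⟩, h, h'⟩
    split_ifs at h' with hos
    · simp only [Prod.mk.injEq, and_true] at h'
      subst h'
      cases f
      exacts [Or.inr ⟨hos, h⟩, Or.inl h]
    · exact Or.inl (h' ▸ h)
  · rintro (h | ⟨h, h'⟩)
    · exact ⟨_, h, by split_ifs <;> rfl⟩
    · exact ⟨_, h', by rw [if_pos h]⟩

theorem GLog.mem_uncommitted_commit {G : GLog Method Stack Id} {os : List (Op Method Stack Id)}
    {o : Op Method Stack Id} :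
    o ∈ (G.commit os).uncommitted ↔ o ∈ G.uncommitted ∧ o ∉ os := by
  simp only [GLog.mem_uncommitted, GLog.commit, List.mem_map]
  constructor
  · rintro ⟨⟨o', f⟩, h, h'⟩
    split_ifs at h' with hos
    · simp at h'
    · cases h'
      exact ⟨h, hos⟩
  · rintro ⟨h, h'⟩
    exact ⟨_, h, by rw [if_neg h']⟩

end Logs

namespace Model

variable {Code : Type u₁} {Method : Type u₂} {Stack : Type u₃} {Id : Type u₄} {Lock : Type u₅}
  (M : Model Code Method Stack Id Lock)

/-! ### Permuting logs by movers. -/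

section Movers

variable {M}

theorem allowed_of_append (hprefix : M.PrefixClosed) {X Y : List (Op Method Stack Id)}
    (h : M.allowed (X ++ Y)) : M.allowed X := by
  induction Y using List.reverseRecOn with
  | nil => simpa using h
  | append_singleton Y o ih => exact ih (hprefix _ o (by simpa using h))

theorem allowed_move_left {y : Op Method Stack Id} {X : List (Op Method Stack Id)}
    (hX : ∀ x ∈ X, M.Mover x y) (l r : List (Op Method Stack Id))
    (h : M.allowed (l ++ (X ++ y :: r))) : M.allowed (l ++ (y :: X ++ r)) := by
  induction X generalizing l with
  | nil => simpa using h
  | cons x X ih =>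
    -- `y` first passes the tail `X`, with `x` absorbed into the context, and then `x` itself.
    have h' := ih (fun z hz => hX z (by simp [hz])) (l ++ [x]) (by simpa using h)
    have := hX x (by simp) l (X ++ r) (by simpa using h')
    simpa using this

/-- A log is below each of its permutations all of whose inversions are movers. -/
theorem logLe_of_inversions {X Y : List (Op Method Stack Id)} (hXY : X.Perm Y) (hY : Y.Nodup)
    (hmov : ∀ a b, List.Sublist [a, b] X → List.Sublist [b, a] Y → M.Mover a b)
    (l : List (Op Method Stack Id)) : M.LogLe (l ++ X) (l ++ Y) := by
  induction Y generalizing X l with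
  | nil => rw [hXY.eq_nil]; exact fun s hs => hs
  | cons y Y ih =>
    obtain ⟨X₁, X₂, rfl⟩ := List.append_of_mem (hXY.mem_iff.2 (List.mem_cons_self (a := y)))
    have hX := hXY.nodup_iff.2 hY
    have hperm : (X₁ ++ X₂).Perm Y := (List.perm_middle.symm.trans hXY).cons_inv
    intro s hs
    have hleft : ∀ x ∈ X₁, M.Mover x y := fun x hx => hmov x y
      (pair_sublist_append.2 (Or.inr (Or.inl ⟨hx, by simp⟩)))
      (by simpa using hperm.subset (List.mem_append_left _ hx))
    have h₁ := allowed_move_left hleft l (X₂ ++ s) (by simpa using hs)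
    have h₂ := ih hperm (List.nodup_cons.1 hY).2
      (fun a b hab hba => hmov a b
        (hab.trans ((List.Sublist.refl X₁).append (List.sublist_cons_self y X₂))) (hba.cons y))
      (l ++ [y]) s (by simpa using h₁)
    simpa using h₂

end Movers

/-! ### Runs of a single transaction and the method calls reachable from code. -/

/-- `M.Run c σ X c' σ'`: performing the operations in `X`, each listed with the code before it,
leads from the code `c` and local state `σ` to `c'` and `σ'`. -/
def Run : Code → Stack → List (Op Method Stack Id × Code) → Code → Stack → Prop
  | c, σ, [], c', σ' => c = c' ∧ σ = σ'
  | c, σ, (o, c₁) :: X, c', σ' =>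
      c₁ = c ∧ o.pre = σ ∧ ∃ c₂, M.step c o.meth c₂ ∧ Run c₂ o.post X c' σ'

/-- The method `m` is called on some path of the code `c`. -/
inductive Calls : Code → Method → Prop
  | here {c : Code} {m : Method} {c' : Code} (h : M.step c m c') : Calls c m
  | later {c : Code} {n : Method} {c' : Code} {m : Method} (h : M.step c n c') (h' : Calls c' m) :
      Calls c m

variable {M}

theorem run_append {X Y : List (Op Method Stack Id × Code)} {c c' : Code} {σ σ' : Stack} :
    M.Run c σ (X ++ Y) c' σ' ↔ ∃ c₁ σ₁, M.Run c σ X c₁ σ₁ ∧ M.Run c₁ σ₁ Y c' σ' := by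
  induction X generalizing c σ with
  | nil => simp [Run]
  | cons e X ih =>
    obtain ⟨o, d⟩ := e
    simp only [List.cons_append, Run, ih]
    constructor
    · rintro ⟨h₁, h₂, c₂, h₃, c₁, σ₁, h₄, h₅⟩
      exact ⟨c₁, σ₁, ⟨h₁, h₂, c₂, h₃, h₄⟩, h₅⟩
    · rintro ⟨c₁, σ₁, ⟨h₁, h₂, c₂, h₃, h₄⟩, h₅⟩
      exact ⟨h₁, h₂, c₂, h₃, c₁, σ₁, h₄, h₅⟩

theorem Run.calls {X : List (Op Method Stack Id × Code)} {c c' : Code} {σ σ' : Stack}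
    (h : M.Run c σ X c' σ') {o : Op Method Stack Id} (ho : o ∈ X.map Prod.fst) :
    M.Calls c o.meth := by
  induction X generalizing c σ with
  | nil => simp at ho
  | cons e X ih =>
    obtain ⟨o', d⟩ := e
    obtain ⟨-, -, c₂, hstep, hrun⟩ := h
    rcases List.mem_cons.1 ho with rfl | ho
    exacts [.here hstep, .later hstep (ih hrun ho)]

/-- Deterministic code has a single path of calls, and code that can finish has no further call, so
a complete run covers the whole path. -/
theorem Run.exists_of_calls (hdet : M.Deterministic) {X : List (Op Method Stack Id × Code)}
    {c c' : Code} {σ σ' : Stack} (h : M.Run c σ X c' σ') (hfin : M.fin c') {m : Method}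
    (hm : M.Calls c m) : ∃ o ∈ X.map Prod.fst, o.meth = m := by
  induction X generalizing c σ with
  | nil =>
    obtain ⟨rfl, -⟩ := h
    cases hm with
    | here h => exact absurd h (hdet.2 _ _ _ hfin)
    | later h _ => exact absurd h (hdet.2 _ _ _ hfin)
  | cons e X ih =>
    obtain ⟨o', d⟩ := e
    obtain ⟨-, -, c₂, hstep, hrun⟩ := h
    cases hm with
    | here h => exact ⟨o', by simp, (hdet.1 _ _ _ _ _ hstep h).1⟩
    | later h h' =>
      rw [← (hdet.1 _ _ _ _ _ hstep h).2] at h'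
      obtain ⟨o, ho, hom⟩ := ih hrun h'
      exact ⟨o, List.mem_cons_of_mem _ ho, hom⟩

/-- Allowedness of the final log suffices, as prefix closure yields that of the intermediate ones;
distinct identifiers give freshness. The guard `X ≠ []` is there because the empty log is not
assumed to be allowed. -/
theorem Run.bigStep (hprefix : M.PrefixClosed) {X : List (Op Method Stack Id × Code)}
    {c c' : Code} {σ σ' : Stack} (h : M.Run c σ X c' σ') (hfin : M.fin c')
    {l : List (Op Method Stack Id)} (hl : X ≠ [] → M.allowed (l ++ X.map Prod.fst))
    (hid : ((l ++ X.map Prod.fst).map Op.id).Nodup) :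
    M.BigStep c σ l σ' (l ++ X.map Prod.fst) := by
  induction X generalizing c σ l with
  | nil =>
    obtain ⟨rfl, rfl⟩ := h
    simpa using BigStep.fin _ _ _ hfin
  | cons e X ih =>
    obtain ⟨⟨m, σ₁, σ₂, id⟩, d⟩ := e
    obtain ⟨-, rfl, c₂, hstep, hrun⟩ := h
    have hl' := hl (by simp)
    have hassoc : ∀ o : Op Method Stack Id, l ++ o :: X.map Prod.fst =
      (l ++ [o]) ++ X.map Prod.fst := by simp
    simp only [List.map_cons, hassoc] at hl' hid ⊢
    refine .step _ _ _ _ _ _ id _ _ hstep ?_ (allowed_of_append hprefix hl')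
      (ih hrun (fun _ => hl') hid)
    rintro o ho rfl
    simp only [List.map_append, List.nodup_append, List.map_cons, List.map_nil] at hid
    exact hid.1.2.2 _ (List.mem_map_of_mem ho) _ (by simp) rfl

/-! ### Effect of a transition on threads, for arbitrary guards and so for both miner and validator.
-/

section Threads

variable {N : ℕ} {stepGuard : Config N Code Method Stack Id → Fin N → Prop}
  {pushGuard : Config N Code Method Stack Id → LLog Code Method Stack Id →
    LLog Code Method Stack Id → Op Method Stack Id → Prop}
  {i : Fin N} {a : Act Method} {C C' : Config N Code Method Stack Id}

/-- The effect of a transition on the program, the local state and the own operations of the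
threads. -/
theorem Trans.thread (h : M.Trans stepGuard pushGuard i a C C') :
    (∀ j, j ≠ i → C'.thr j = C.thr j) ∧ ∃ c₁, (C.thr i).prog = .tx c₁ ∧
      ((∃ c₂ o, a = .app o.meth ∧ stepGuard C i ∧ M.step c₁ o.meth c₂ ∧
          o.pre = (C.thr i).stack ∧ (C'.thr i).prog = .tx c₂ ∧ (C'.thr i).stack = o.post ∧
          (C'.thr i).log.ownCode = (C.thr i).log.ownCode ++ [(o, c₁)]) ∨
        (∃ c₂ o, a = .unapp ∧ (C'.thr i).prog = .tx c₂ ∧ (C'.thr i).stack = o.pre ∧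
          (C.thr i).log.ownCode = (C'.thr i).log.ownCode ++ [(o, c₂)]) ∨
        (a ≠ .cmt ∧ (C'.thr i).prog = .tx c₁ ∧ (C'.thr i).stack = (C.thr i).stack ∧
          (C'.thr i).log.ownCode = (C.thr i).log.ownCode) ∨
        (a = .cmt ∧ M.fin c₁ ∧ (C'.thr i).prog = .skip ∧ (C'.thr i).stack = (C.thr i).stack ∧
          (C'.thr i).log.ownCode = [])) := by
  cases h with
  | step _ _ t hguard hlocal =>
    refine ⟨fun j hj => Function.update_of_ne hj _ _, ?_⟩
    simp only [Config.setThr, Function.update_self]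
    generalize C.thr i = t₀ at hlocal
    cases hlocal with
    | app c₁ c₂ m σ₁ σ₂ id L hstep hallow hfresh =>
      exact ⟨c₁, rfl, Or.inl ⟨c₂, ⟨m, σ₁, σ₂, id⟩, rfl, hguard, hstep, rfl, rfl, rfl,
        LLog.ownCode_append ..⟩⟩
    | unapp c₁ c₂ m σ₁ σ₂ id L =>
      exact ⟨c₂, rfl, Or.inr (Or.inl ⟨c₁, ⟨m, σ₁, σ₂, id⟩, rfl, rfl, rfl,
        LLog.ownCode_append ..⟩)⟩
  | push _ c c' σ L₁ L₂ o hthr =>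
    refine ⟨fun j hj => Function.update_of_ne hj _ _, c, by rw [hthr], Or.inr (Or.inr (Or.inl ?_))⟩
    simp [hthr, LLog.ownCode_append, LLog.ownCode_pshd, LLog.ownCode_npshd]
  | unpush _ c c' σ L₁ L₂ G₁ G₂ o hthr =>
    refine ⟨fun j hj => Function.update_of_ne hj _ _, c, by rw [hthr], Or.inr (Or.inr (Or.inl ?_))⟩
    simp [hthr, LLog.ownCode_append, LLog.ownCode_pshd, LLog.ownCode_npshd]
  | pull _ c σ L o hthr =>
    refine ⟨fun j hj => Function.update_of_ne hj _ _, c, by rw [hthr], Or.inr (Or.inr (Or.inl ?_))⟩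
    simp [hthr, Config.setThr, LLog.ownCode_append, LLog.ownCode_pld, LLog.ownCode_nil]
  | unpull _ c σ L₁ L₂ o hthr =>
    refine ⟨fun j hj => Function.update_of_ne hj _ _, c, by rw [hthr], Or.inr (Or.inr (Or.inl ?_))⟩
    simp [hthr, Config.setThr, LLog.ownCode_append, LLog.ownCode_pld]
  | cmt _ c σ L hthr hfin =>
    refine ⟨fun j hj => Function.update_of_ne hj _ _, c, by rw [hthr], Or.inr (Or.inr (Or.inr ?_))⟩
    simp [hthr, hfin, LLog.ownCode_nil]

variable (M) in
/-- While thread `i` is running, its own operations form a run of its transaction. -/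
def Runs (c : Fin N → Code) (σ : Fin N → Stack) (C : Config N Code Method Stack Id) : Prop :=
  ∀ i c', (C.thr i).prog = .tx c' → M.Run (c i) (σ i) (C.thr i).log.ownCode c' (C.thr i).stack

theorem Runs.init (c : Fin N → Code) (σ : Fin N → Stack) :
    M.Runs c σ (Config.init c σ : Config N Code Method Stack Id) := by
  intro i c' h
  cases h
  exact ⟨rfl, rfl⟩

theorem Runs.trans {c : Fin N → Code} {σ : Fin N → Stack} (hC : M.Runs c σ C)
    (h : M.Trans stepGuard pushGuard i a C C') : M.Runs c σ C' := by
  obtain ⟨hne, c₁, hc₁, hi⟩ := h.thread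
  intro j c' hj
  by_cases hji : j = i
  · subst hji
    have hrun := hC j c₁ hc₁
    rcases hi with ⟨c₂, o, -, -, hstep, hpre, hprog, hst, hown⟩ | ⟨c₂, o, -, hprog, hst, hown⟩ |
      ⟨-, hprog, hst, hown⟩ | ⟨-, -, hprog, -⟩
    · rw [hprog] at hj
      cases hj
      rw [hown, hst, run_append]
      exact ⟨_, _, hrun, rfl, hpre, _, hstep, rfl, rfl⟩
    · rw [hprog] at hj
      cases hj
      -- Splitting off the last operation identifies the code and local state before it with those
      -- that the backward step restores.
      rw [hown, run_append] at hrun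
      obtain ⟨_, _, hrun, rfl, hpre, -⟩ := hrun
      rwa [hst, hpre]
    · rw [hprog] at hj
      cases hj
      rwa [hown, hst]
    · rw [hprog] at hj
      cases hj
  · rw [hne j hji] at hj ⊢
    exact hC j c' hj

theorem Runs.calls {c : Fin N → Code} {σ : Fin N → Stack} (hC : M.Runs c σ C)
    {j : Fin N} {c' : Code} (hj : (C.thr j).prog = .tx c') {o : Op Method Stack Id}
    (ho : o ∈ (C.thr j).log.own) : M.Calls (c j) o.meth :=
  (hC j c' hj).calls (by rwa [← LLog.own_eq])

end Threads

/-! ### From recorded locks to commutation of unrelated transactions. -/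

section Miner

variable {N : ℕ}

variable (M) in
/-- The invariant of miner runs: the locks of all performed method calls have been recorded. -/
structure MinerInv (c : Fin N → Code) (σ : Fin N → Stack)
    (K : MConfig N Code Method Stack Id Lock) : Prop where
  runs : M.Runs c σ K.conf
  held : ∀ i, ∀ k ∈ K.held i, (i, EventKind.lock k) ∈ K.events
  own : ∀ i, ∀ o ∈ (K.conf.thr i).log.own, ∀ k ∈ M.locks o.meth,
    (i, EventKind.lock k) ∈ K.events
  done : ∀ i, (K.conf.thr i).prog = .skip → (i, EventKind.commit) ∈ K.events ∧
    ∀ m, M.Calls (c i) m → ∀ k ∈ M.locks m, (i, EventKind.lock k) ∈ K.events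

theorem MinerInv.init (c : Fin N → Code) (σ : Fin N → Stack) :
    M.MinerInv c σ (⟨Config.init c σ, fun _ => ∅, []⟩ : MConfig N Code Method Stack Id Lock) where
  runs := .init c σ
  held := by simp
  own := by simp [Config.init, LLog.own]
  done := by simp [Config.init]

/-- The invariant speaks of recorded events, which are never erased, rather than of held locks, so
it survives rollback, release and commit. -/
theorem MinerInv.trans {c : Fin N → Code} {σ : Fin N → Stack} (hdet : M.Deterministic)
    {K : MConfig N Code Method Stack Id Lock}
    (hK : M.MinerInv c σ K) {i : Fin N} {a : Act Method} {C' : Config N Code Method Stack Id}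
    (h : M.PPTrans i a K.conf C') {held' : Fin N → Set Lock} {E : EventLog N Method Lock}
    (happ : ∀ m, a = .app m → M.locks m ⊆ K.held i)
    (hcmt : a = .cmt → (i, EventKind.commit) ∈ E)
    (hheld : ∀ j, held' j ⊆ K.held j) (hE : K.events ⊆ E) :
    M.MinerInv c σ ⟨C', held', E⟩ := by
  obtain ⟨hne, c₁, hc₁, hi⟩ := h.thread
  refine ⟨hK.runs.trans h, fun j k hk => hE (hK.held j k (hheld j hk)), fun j o ho k hk => ?_,
    fun j hj => ?_⟩
  · dsimp only at ho ⊢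
    by_cases hji : j = i
    · subst hji
      have hold : ∀ o ∈ (K.conf.thr j).log.ownCode.map Prod.fst, ∀ k ∈ M.locks o.meth,
          (j, EventKind.lock k) ∈ E := by
        intro o ho k hk
        rw [← LLog.own_eq] at ho
        exact hE (hK.own j o ho k hk)
      rw [LLog.own_eq] at ho
      rcases hi with ⟨c₂, o', ha, -, -, -, -, -, hown⟩ | ⟨c₂, o', -, -, -, hown⟩ |
        ⟨-, -, -, hown⟩ | ⟨-, -, -, -, hown⟩
      · rw [hown] at ho
        simp only [List.map_append, List.map_cons, List.map_nil, List.mem_append,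
          List.mem_singleton] at ho
        rcases ho with ho | rfl
        · exact hold o ho k hk
        · exact hE (hK.held j k (happ _ ha hk))
      · refine hold o ?_ k hk
        rw [hown, List.map_append]
        exact List.mem_append_left _ ho
      · exact hold o (hown ▸ ho) k hk
      · simp [hown] at ho
    · rw [hne j hji] at ho
      exact hE (hK.own j o ho k hk)
  · dsimp only at hj ⊢
    by_cases hji : j = i
    · subst hji
      rcases hi with ⟨c₂, o', -, -, -, -, hprog, -⟩ | ⟨c₂, o', -, hprog, -⟩ | ⟨-, hprog, -⟩ |
        ⟨ha, hfin, -⟩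
      · rw [hprog] at hj; cases hj
      · rw [hprog] at hj; cases hj
      · rw [hprog] at hj; cases hj
      · refine ⟨hcmt ha, fun m hm k hk => ?_⟩
        -- At commit the run is complete, so every reachable call has an own operation, whose locks
        -- are on record.
        obtain ⟨o, ho, rfl⟩ := (hK.runs j c₁ hc₁).exists_of_calls hdet hfin hm
        rw [← LLog.own_eq] at ho
        exact hE (hK.own j o ho k hk)
    · rw [hne j hji] at hj
      exact ⟨hE (hK.done j hj).1, fun m hm k hk => hE ((hK.done j hj).2 m hm k hk)⟩

theorem MinerInv.weaken {c : Fin N → Code} {σ : Fin N → Stack}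
    {K : MConfig N Code Method Stack Id Lock} (hK : M.MinerInv c σ K)
    {held' : Fin N → Set Lock} {E : EventLog N Method Lock} (hE : K.events ⊆ E)
    (hheld : ∀ j, ∀ k ∈ held' j, k ∈ K.held j ∨ (j, EventKind.lock k) ∈ E) :
    M.MinerInv c σ ⟨K.conf, held', E⟩ where
  runs := hK.runs
  held j k hk := (hheld j k hk).elim (fun h => hE (hK.held j k h)) id
  own j o ho k hk := hE (hK.own j o ho k hk)
  done j hj := ⟨hE (hK.done j hj).1, fun m hm k hk => hE ((hK.done j hj).2 m hm k hk)⟩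

theorem MinerInv.step {c : Fin N → Code} {σ : Fin N → Stack} (hdet : M.Deterministic)
    {K K' : MConfig N Code Method Stack Id Lock} (hK : M.MinerInv c σ K)
    (h : M.MinerStep K K') : M.MinerInv c σ K' := by
  have hempty : ∀ i j, Function.update K.held i ∅ j ⊆ K.held j := by
    intro i j
    by_cases hji : j = i
    · subst hji; simp
    · rw [Function.update_of_ne hji]
  cases h with
  | start i hnew =>
    exact hK.weaken (List.subset_append_left _ _) fun j k hk => Or.inl hk
  | lock i k =>
    refine hK.weaken (List.subset_append_left _ _) fun j k' hk' => ?_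
    by_cases hji : j = i
    · subst hji
      rw [Function.update_self] at hk'
      rcases hk' with rfl | hk'
      · exact Or.inr (by simp)
      · exact Or.inl hk'
    · rw [Function.update_of_ne hji] at hk'
      exact Or.inl hk'
  | op i m C' hstarted hlocks htrans =>
    exact hK.trans hdet htrans (fun n hn => by cases hn; exact hlocks) (by simp)
      (fun _ => subset_rfl) (List.subset_append_left _ _)
  | silent i a C' hstarted hact htrans =>
    refine hK.trans hdet htrans ?_ ?_ (fun _ => subset_rfl) (List.Subset.refl _)
    · rintro m rfl; simp at hact
    · rintro rfl; simp at hact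
  | commit i C' hstarted htrans =>
    exact hK.trans hdet htrans (by simp) (by simp) (hempty i) (List.subset_append_left _ _)
  | release i => exact hK.weaken (List.Subset.refl _) fun j k hk => Or.inl (hempty i j hk)

variable (M) in
/-- Transactions that are not related by `hb` call commuting methods only. -/
def UnrelatedCommute (c : Fin N → Code) (hb : Fin N → Fin N → Prop) : Prop :=
  ∀ i j, i ≠ j → ¬ hb i j → ¬ hb j i → ∀ m n, M.Calls (c i) m → M.Calls (c j) n → M.Commute m n

theorem MinerEmits.unrelatedCommute {c : Fin N → Code} {σ : Fin N → Stack}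
    {hb : Fin N → Fin N → Prop} (hdet : M.Deterministic) (hboost : M.BoostingRule)
    (h : M.MinerEmits c σ hb) : M.UnrelatedCommute c hb := by
  obtain ⟨K, hK, hskip, hE⟩ := h
  have hinv : M.MinerInv c σ K := by
    clear hskip hE
    induction hK with
    | refl => exact .init c σ
    | tail _ hstep ih => exact ih.step hdet hstep
  intro i j hij hnij hnji m n hm hn
  by_contra hmn
  obtain ⟨k, hkm, hkn⟩ := hboost m n hmn
  obtain ⟨hci, hli⟩ := hinv.done i (hskip i)
  obtain ⟨hcj, hlj⟩ := hinv.done j (hskip j)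
  -- Both commit events occur, in some order, and either order together with the common lock `k`
  -- gives an instance of `hb`.
  rcases pair_sublist_total (by simpa using hij) hci hcj with hsub | hsub
  · exact hnij ((hE i j).2 ⟨hsub, k, hli m hm k hkm, hlj n hn k hkn⟩)
  · exact hnji ((hE j i).2 ⟨hsub, k, hlj n hn k hkn, hli m hm k hkm⟩)

end Miner

/-! ### A local log against the shared log. -/

section LogInvariant

variable (M) in
/-- The entries `e`, `e'` of a local log, in this order, move across each other if the shared log
`G` has them, or may still get them, in the other order. -/
def EntryMover (G : GLog Method Stack Id) (e e' : Op Method Stack Id × LFlag Code) : Prop :=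
  (∃ d, e'.2 = .pshd d) →
    ((∃ d, e.2 = .npshd d) ∨ ((∃ d, e.2 = .pshd d) ∧ List.Sublist [e'.1, e.1] G.ops)) →
      M.Mover e'.1 e.1

variable (M) in
/-- The relation of a local log `L` to the shared log `G`. -/
structure LogOK (G : GLog Method Stack Id) (L : LLog Code Method Stack Id) : Prop where
  pushed : ∀ o ∈ L.pushed, o ∈ G.uncommitted
  unpushed : ∀ o ∈ L.unpushed, ∀ g ∈ G.ops, g.id ≠ o.id
  nodup : (L.own.map Op.id).Nodup
  movers : L.Pairwise (M.EntryMover G)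

theorem EntryMover.mono {G G' : GLog Method Stack Id} {e e' : Op Method Stack Id × LFlag Code}
    (h : M.EntryMover G e e') (hG : List.Sublist G'.ops G.ops) : M.EntryMover G' e e' :=
  fun h₁ h₂ => h h₁ (h₂.imp id fun h₃ => ⟨h₃.1, h₃.2.trans hG⟩)

/-- The appended operation comes last in the shared log, so a new out-of-order pair would have to
end in it; `he` excludes that. -/
theorem EntryMover.push {G : GLog Method Stack Id} {e e' : Op Method Stack Id × LFlag Code}
    {o : Op Method Stack Id} {f : GFlag} (h : M.EntryMover G e e')
    (he : ∀ d, e.2 = .pshd d → e.1 ≠ o) : M.EntryMover (G ++ [(o, f)]) e e' := by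
  refine fun h₁ h₂ => h h₁ (h₂.imp id ?_)
  rintro ⟨⟨d, hd⟩, h₃⟩
  refine ⟨⟨d, hd⟩, ?_⟩
  rw [GLog.ops_append, pair_sublist_append] at h₃
  rcases h₃ with h₃ | ⟨-, h₃⟩ | h₃
  · exact h₃
  · exact absurd (by simpa [GLog.ops] using h₃) (he d hd)
  · simpa [GLog.ops] using h₃.length_le

theorem LogOK.nil (G : GLog Method Stack Id) :
    M.LogOK G ([] : LLog Code Method Stack Id) where
  pushed := by simp [LLog.pushed]
  unpushed := by simp [LLog.unpushed]
  nodup := by simp [LLog.own]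
  movers := .nil

theorem LogOK.sublist {G : GLog Method Stack Id} {L L' : LLog Code Method Stack Id}
    (h : M.LogOK G L) (hL : List.Sublist L' L) : M.LogOK G L' where
  pushed o ho := h.pushed o ((hL.filterMap _).subset ho)
  unpushed o ho := h.unpushed o ((hL.filterMap _).subset ho)
  nodup := h.nodup.sublist ((hL.filterMap _).map _)
  movers := h.movers.sublist hL

/-- `EntryMover` only constrains pairs whose second entry is pushed, so a new unpushed entry at the
end adds no condition. -/
theorem LogOK.app {G : GLog Method Stack Id} {L : LLog Code Method Stack Id}
    (h : M.LogOK G L) {o : Op Method Stack Id} {c : Code} (hL : ∀ o' ∈ L.own, o'.id ≠ o.id)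
    (hG : ∀ g ∈ G.ops, g.id ≠ o.id) : M.LogOK G (L ++ [(o, .npshd c)]) where
  pushed o' ho' := by
    obtain ⟨d, hd⟩ := LLog.mem_pushed.1 ho'
    exact h.pushed o' (LLog.mem_pushed.2 ⟨d, by simpa using hd⟩)
  unpushed o' ho' := by
    obtain ⟨d, hd⟩ := LLog.mem_unpushed.1 ho'
    simp only [List.mem_append, List.mem_singleton, Prod.mk.injEq] at hd
    rcases hd with hd | ⟨rfl, -⟩
    exacts [h.unpushed o' (LLog.mem_unpushed.2 ⟨d, hd⟩), hG]
  nodup := by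
    rw [LLog.own_append, List.map_append, List.nodup_append]
    refine ⟨h.nodup, by simp [LLog.own_npshd, LLog.own_nil], ?_⟩
    rintro _ ha _ hb rfl
    obtain ⟨o', ho', rfl⟩ := List.mem_map.1 ha
    simp only [LLog.own_npshd, LLog.own_nil, List.map_cons, List.map_nil,
      List.mem_singleton] at hb
    exact hL o' ho' hb
  movers := by
    refine List.pairwise_append.2 ⟨h.movers, List.pairwise_singleton _ _, ?_⟩
    rintro e - e' he' ⟨d, hd⟩
    rw [List.mem_singleton.1 he'] at hd
    cases hd

theorem LogOK.pull {G : GLog Method Stack Id} {L : LLog Code Method Stack Id}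
    (h : M.LogOK G L) (o : Op Method Stack Id) : M.LogOK G (L ++ [(o, .pld)]) where
  pushed o' ho' := by
    obtain ⟨d, hd⟩ := LLog.mem_pushed.1 ho'
    exact h.pushed o' (LLog.mem_pushed.2 ⟨d, by simpa using hd⟩)
  unpushed o' ho' := by
    obtain ⟨d, hd⟩ := LLog.mem_unpushed.1 ho'
    exact h.unpushed o' (LLog.mem_unpushed.2 ⟨d, by simpa using hd⟩)
  nodup := by simpa [LLog.own_append, LLog.own_pld, LLog.own_nil] using h.nodup
  movers := by
    refine List.pairwise_append.2 ⟨h.movers, List.pairwise_singleton _ _, ?_⟩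
    rintro e - e' he' ⟨d, hd⟩
    rw [List.mem_singleton.1 he'] at hd
    cases hd

/-- Pushing `o` overtakes the earlier entries that are still unpushed, and the Push premise covers
these. The later entries that are already pushed have overtaken `o`; the invariant already held
those movers while `o` was unpushed. -/
theorem LogOK.push {G : GLog Method Stack Id} {L₁ L₂ : LLog Code Method Stack Id}
    {o : Op Method Stack Id} {c : Code} (h : M.LogOK G (L₁ ++ (o, .npshd c) :: L₂))
    (hmov : ∀ o' ∈ L₁.unpushed, M.Mover o o') :
    M.LogOK (G ++ [(o, .gUCmt)]) (L₁ ++ (o, .pshd c) :: L₂) := by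
  have hoG : ∀ g ∈ G.ops, g.id ≠ o.id := h.unpushed o (LLog.mem_unpushed.2 ⟨c, by simp⟩)
  have hnd := h.nodup
  rw [LLog.own_append, LLog.own_npshd, List.perm_middle.map Op.id |>.nodup_iff, List.map_cons,
    List.nodup_cons, List.mem_map] at hnd
  have hne : ∀ e ∈ L₁ ++ L₂, e.1 ∈ LLog.own (L₁ ++ L₂) → e.1.id ≠ o.id := fun e _ he heq =>
    hnd.1 ⟨e.1, by rwa [LLog.own_append] at he, heq⟩
  have hne' : ∀ e ∈ L₁ ++ L₂, ∀ d, e.2 = .pshd d → e.1 ≠ o := by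
    rintro ⟨o', f⟩ he d rfl rfl
    exact hne _ he (LLog.mem_own.2 (Or.inr ⟨d, he⟩)) rfl
  obtain ⟨hm₁, hm₂, hm₃⟩ := List.pairwise_append.1 h.movers
  rw [List.pairwise_cons] at hm₂
  refine ⟨fun o' ho' => ?_, fun o' ho' g hg => ?_, ?_, ?_⟩
  · obtain ⟨d, hd⟩ := LLog.mem_pushed.1 ho'
    rw [GLog.uncommitted_append, List.mem_append]
    simp only [List.mem_append, List.mem_cons, Prod.mk.injEq] at hd
    rcases hd with hd | ⟨rfl, -⟩ | hd
    · exact Or.inl (h.pushed _ (LLog.mem_pushed.2 ⟨d, by simp [hd]⟩))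
    · exact Or.inr (by simp [GLog.uncommitted])
    · exact Or.inl (h.pushed _ (LLog.mem_pushed.2 ⟨d, by simp [hd]⟩))
  · obtain ⟨d, hd⟩ := LLog.mem_unpushed.1 ho'
    have hd' : (o', LFlag.npshd d) ∈ L₁ ++ L₂ := by simpa using hd
    have hd'' : (o', LFlag.npshd d) ∈ L₁ ++ (o, .npshd c) :: L₂ := by
      rcases List.mem_append.1 hd' with h' | h' <;> simp [h']
    rw [GLog.ops_append, List.mem_append] at hg
    rcases hg with hg | hg
    · exact h.unpushed _ (LLog.mem_unpushed.2 ⟨d, hd''⟩) g hg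
    · have : g = o := by simpa [GLog.ops] using hg
      rw [this]
      exact (hne _ hd' (LLog.mem_own.2 (Or.inl ⟨d, hd'⟩))).symm
  · simpa [LLog.own_append, LLog.own_pshd, LLog.own_npshd] using h.nodup
  · refine List.pairwise_append.2 ⟨?_, List.pairwise_cons.2 ⟨?_, ?_⟩, ?_⟩
    · exact hm₁.imp_of_mem fun he _ h' => h'.push (hne' _ (by simp [he]))
    · exact fun e' he' h₁ _ => hm₂.1 e' he' h₁ (Or.inl ⟨c, rfl⟩)
    · exact hm₂.2.imp_of_mem fun he _ h' => h'.push (hne' _ (by simp [he]))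
    · rintro ⟨o₁, f⟩ he e' he'
      rcases List.mem_cons.1 he' with rfl | he'
      · rintro - (⟨d, rfl⟩ | ⟨⟨d, rfl⟩, hsub⟩)
        · exact hmov _ (LLog.mem_unpushed.2 ⟨d, he⟩)
        -- `o` is new in the shared log and stands last there, so it precedes nothing.
        · exfalso
          rw [GLog.ops_append, pair_sublist_append] at hsub
          rcases hsub with hsub | ⟨hsub, -⟩ | hsub
          · exact hoG o (hsub.subset (by simp)) rfl
          · exact hoG o hsub rfl
          · simpa [GLog.ops] using hsub.length_le
      · exact (hm₃ _ he _ (by simp [he'])).push (hne' _ (by simp [he]))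

theorem LogOK.push_other {G : GLog Method Stack Id} {L : LLog Code Method Stack Id}
    {o : Op Method Stack Id} (h : M.LogOK G L) (ho : ∀ o' ∈ L.own, o'.id ≠ o.id) :
    M.LogOK (G ++ [(o, .gUCmt)]) L where
  pushed o' ho' := by
    rw [GLog.uncommitted_append, List.mem_append]
    exact Or.inl (h.pushed o' ho')
  unpushed o' ho' g hg := by
    rw [GLog.ops_append, List.mem_append] at hg
    rcases hg with hg | hg
    · exact h.unpushed o' ho' g hg
    · have : g = o := by simpa [GLog.ops] using hg
      rw [this]
      exact (ho o' (LLog.mem_own_of_unpushed ho')).symm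
  nodup := h.nodup
  movers := h.movers.imp_of_mem fun {e _} he _ h' => h'.push fun d hd heq =>
    ho e.1 (LLog.mem_own.2 (Or.inr ⟨d, by rw [← hd]; exact he⟩)) (by rw [heq])

theorem LogOK.unpush {G₁ G₂ : GLog Method Stack Id} {L₁ L₂ : LLog Code Method Stack Id}
    {o : Op Method Stack Id} {c : Code}
    (h : M.LogOK (G₁ ++ (o, .gUCmt) :: G₂) (L₁ ++ (o, .pshd c) :: L₂))
    (hG : ∀ g ∈ GLog.ops (G₁ ++ G₂), g.id ≠ o.id)
    (hmov : ∀ o' ∈ L₂.pushed, M.Mover o' o) :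
    M.LogOK (G₁ ++ G₂) (L₁ ++ (o, .npshd c) :: L₂) := by
  have hsub : List.Sublist (GLog.ops (G₁ ++ G₂)) (GLog.ops (G₁ ++ (o, .gUCmt) :: G₂)) :=
    ((List.Sublist.refl G₁).append (List.sublist_cons_self _ G₂)).map _
  have hnd := h.nodup
  rw [LLog.own_append, LLog.own_pshd, List.perm_middle.map Op.id |>.nodup_iff, List.map_cons,
    List.nodup_cons, List.mem_map] at hnd
  obtain ⟨hm₁, hm₂, hm₃⟩ := List.pairwise_append.1 h.movers
  rw [List.pairwise_cons] at hm₂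
  refine ⟨fun o' ho' => ?_, fun o' ho' g hg => ?_, ?_, ?_⟩
  · obtain ⟨d, hd⟩ := LLog.mem_pushed.1 ho'
    have hd' : (o', LFlag.pshd d) ∈ L₁ ++ L₂ := by simpa using hd
    have hd'' : (o', LFlag.pshd d) ∈ L₁ ++ (o, .pshd c) :: L₂ := by
      rcases List.mem_append.1 hd' with h' | h' <;> simp [h']
    have hne : o' ≠ o := by
      rintro rfl
      refine hnd.1 ⟨o', ?_, rfl⟩
      rw [← LLog.own_append]
      exact LLog.mem_own.2 (Or.inr ⟨d, hd'⟩)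
    have := GLog.mem_uncommitted.1 (h.pushed o' (LLog.mem_pushed.2 ⟨d, hd''⟩))
    exact GLog.mem_uncommitted.2 (by simpa [hne] using this)
  · obtain ⟨d, hd⟩ := LLog.mem_unpushed.1 ho'
    simp only [List.mem_append, List.mem_cons, Prod.mk.injEq] at hd
    rcases hd with hd | ⟨rfl, -⟩ | hd
    · exact h.unpushed o' (LLog.mem_unpushed.2 ⟨d, by simp [hd]⟩) g (hsub.subset hg)
    · exact hG g hg
    · exact h.unpushed o' (LLog.mem_unpushed.2 ⟨d, by simp [hd]⟩) g (hsub.subset hg)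
  · simpa [LLog.own_append, LLog.own_pshd, LLog.own_npshd] using h.nodup
  · refine List.pairwise_append.2 ⟨?_, List.pairwise_cons.2 ⟨?_, ?_⟩, ?_⟩
    · exact hm₁.imp fun h' => h'.mono hsub
    -- Once unpushed, `o` can only return behind the pushed entries of `L₂`; the Unpush premise
    -- provides exactly these movers.
    · rintro ⟨o', f⟩ he' ⟨d, rfl⟩ -
      exact hmov o' (LLog.mem_pushed.2 ⟨d, he'⟩)
    · exact hm₂.2.imp fun h' => h'.mono hsub
    · intro e he e' he'
      rcases List.mem_cons.1 he' with rfl | he'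
      · rintro ⟨d, hd⟩
        cases hd
      · exact (hm₃ _ he _ (by simp [he'])).mono hsub

theorem LogOK.unpush_other {G₁ G₂ : GLog Method Stack Id} {L : LLog Code Method Stack Id}
    {o : Op Method Stack Id} (h : M.LogOK (G₁ ++ (o, .gUCmt) :: G₂) L)
    (ho : ∀ o' ∈ L.own, o'.id ≠ o.id) : M.LogOK (G₁ ++ G₂) L := by
  have hsub : List.Sublist (GLog.ops (G₁ ++ G₂)) (GLog.ops (G₁ ++ (o, .gUCmt) :: G₂)) :=
    ((List.Sublist.refl G₁).append (List.sublist_cons_self _ G₂)).map _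
  refine ⟨fun o' ho' => ?_, fun o' ho' g hg => h.unpushed o' ho' g (hsub.subset hg), h.nodup,
    h.movers.imp fun h' => h'.mono hsub⟩
  have hne : o' ≠ o := by
    rintro rfl
    exact ho o' (LLog.mem_own_of_pushed ho') rfl
  have := GLog.mem_uncommitted.1 (h.pushed o' ho')
  exact GLog.mem_uncommitted.2 (by simpa [hne] using this)

theorem LogOK.commit_other {G : GLog Method Stack Id} {L : LLog Code Method Stack Id}
    {os : List (Op Method Stack Id)} (h : M.LogOK G L) (ho : ∀ o' ∈ L.own, o' ∉ os) :
    M.LogOK (G.commit os) L where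
  pushed o' ho' :=
    GLog.mem_uncommitted_commit.2 ⟨h.pushed o' ho', ho o' (LLog.mem_own_of_pushed ho')⟩
  unpushed o' ho' := by
    rw [GLog.ops_commit]
    exact h.unpushed o' ho'
  nodup := h.nodup
  movers := h.movers.imp fun h' => h'.mono (by rw [GLog.ops_commit])

/-- With nothing left unpushed, `EntryMover` reduces to its clause on pairs of pushed entries that
the shared log has in the opposite order. -/
theorem LogOK.mover_of_sublist {G : GLog Method Stack Id} {L : LLog Code Method Stack Id}
    (h : M.LogOK G L) (hL : L.unpushed = []) {a b : Op Method Stack Id}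
    (hba : List.Sublist [b, a] L.own) (hab : List.Sublist [a, b] G.ops) : M.Mover a b := by
  have hpair : L.own.Pairwise fun x y => List.Sublist [y, x] G.ops → M.Mover y x := by
    refine List.pairwise_filterMap.2 (h.movers.imp_of_mem ?_)
    rintro ⟨x, f⟩ ⟨y, f'⟩ hx hy hxy x' hx' y' hy' hsub
    have hnot : ∀ z d, (z, LFlag.npshd d) ∉ L := fun z d hz => by
      have := LLog.mem_unpushed.2 ⟨d, hz⟩
      simp [hL] at this
    cases f with
    | npshd d => exact absurd hx (hnot _ _)
    | pld => simp at hx'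
    | pshd d =>
      cases f' with
      | npshd d => exact absurd hy (hnot _ _)
      | pld => simp at hy'
      | pshd d' =>
        simp only [Option.some.injEq] at hx' hy'
        subst hx' hy'
        exact hxy ⟨d', rfl⟩ (Or.inr ⟨⟨d, rfl⟩, hsub⟩)
  exact List.pairwise_pair.1 (hpair.sublist hba) hab

end LogInvariant

/-! ### Invariants of the whole configuration and the simulation. -/

section Simulation

variable {N : ℕ} {stepGuard : Config N Code Method Stack Id → Fin N → Prop}
  {pushGuard : Config N Code Method Stack Id → LLog Code Method Stack Id →
    LLog Code Method Stack Id → Op Method Stack Id → Prop}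
  {i : Fin N} {a : Act Method} {C C' : Config N Code Method Stack Id}

variable (M) in
/-- The invariant that relates the shared log to the local logs. -/
structure LogInv (C : Config N Code Method Stack Id) : Prop where
  nodup : (C.glob.ops.map Op.id).Nodup
  allow : C.glob.ops ≠ [] → M.allowed C.glob.ops
  uncommitted : ∀ o ∈ C.glob.uncommitted, ∃ i, o ∈ (C.thr i).log.pushed
  ok : ∀ i, M.LogOK C.glob (C.thr i).log
  disjoint : ∀ i j, i ≠ j → ∀ o ∈ (C.thr i).log.own, ∀ o' ∈ (C.thr j).log.own, o.id ≠ o'.id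

theorem LogInv.init (c : Fin N → Code) (σ : Fin N → Stack) :
    M.LogInv (Config.init c σ : Config N Code Method Stack Id) where
  nodup := by simp [Config.init, GLog.ops]
  allow := by simp [Config.init, GLog.ops]
  uncommitted := by simp [Config.init, GLog.uncommitted]
  ok _ := .nil _
  disjoint := by simp [Config.init, LLog.own]

/-- Frame lemma for all rules: an uncommitted operation must be pushed in the new thread or have
another owner, and new own operations need identifiers that differ from those of all existing own
operations. -/
theorem LogInv.update (h : M.LogInv C) {t : Thread Code Method Stack Id}
    {G : GLog Method Stack Id} (hnodup : (G.ops.map Op.id).Nodup)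
    (hallow : G.ops ≠ [] → M.allowed G.ops)
    (hunc : ∀ o ∈ G.uncommitted,
      o ∈ t.log.pushed ∨ (o ∈ C.glob.uncommitted ∧ o ∉ (C.thr i).log.pushed))
    (hok : M.LogOK G t.log) (hok' : ∀ j, j ≠ i → M.LogOK G (C.thr j).log)
    (hown : ∀ o ∈ t.log.own,
      o ∈ (C.thr i).log.own ∨ ∀ j, ∀ o' ∈ (C.thr j).log.own, o'.id ≠ o.id) :
    M.LogInv ⟨Function.update C.thr i t, G⟩ where
  nodup := hnodup
  allow := hallow
  uncommitted o ho := by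
    rcases hunc o ho with h' | ⟨h', hi⟩
    · exact ⟨i, by simpa using h'⟩
    · obtain ⟨j, hj⟩ := h.uncommitted o h'
      have hji : j ≠ i := by
        rintro rfl
        exact hi hj
      exact ⟨j, by simpa [Function.update_of_ne hji] using hj⟩
  ok j := by
    by_cases hji : j = i
    · subst hji
      simpa using hok
    · simpa [Function.update_of_ne hji] using hok' j hji
  disjoint j k hjk o ho o' ho' := by
    dsimp only at ho ho'
    by_cases hji : j = i
    · subst hji
      rw [Function.update_of_ne hjk.symm] at ho'
      rw [Function.update_self] at ho
      rcases hown o ho with h' | h'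
      · exact h.disjoint j k hjk o h' o' ho'
      · exact (h' k o' ho').symm
    · rw [Function.update_of_ne hji] at ho
      by_cases hki : k = i
      · subst hki
        rw [Function.update_self] at ho'
        rcases hown o' ho' with h' | h'
        · exact h.disjoint j k hjk o ho o' h'
        · exact h' j o ho
      · rw [Function.update_of_ne hki] at ho'
        exact h.disjoint j k hjk o ho o' ho'

theorem LogInv.setThr (h : M.LogInv C) {t : Thread Code Method Stack Id}
    (hpushed : ∀ o ∈ (C.thr i).log.pushed, o ∈ t.log.pushed) (hok : M.LogOK C.glob t.log)
    (hown : ∀ o ∈ t.log.own,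
      o ∈ (C.thr i).log.own ∨ ∀ j, ∀ o' ∈ (C.thr j).log.own, o'.id ≠ o.id) :
    M.LogInv (C.setThr i t) := by
  refine h.update h.nodup h.allow (fun o ho => ?_) hok (fun j _ => h.ok j) hown
  by_cases hi : o ∈ (C.thr i).log.pushed
  exacts [Or.inl (hpushed o hi), Or.inr ⟨ho, hi⟩]

theorem ne_of_nodup_ids {G₁ G₂ : GLog Method Stack Id} {e : Op Method Stack Id × GFlag}
    (h : ((GLog.ops (G₁ ++ e :: G₂)).map Op.id).Nodup) :
    ∀ g ∈ GLog.ops (G₁ ++ G₂), g.id ≠ e.1.id := by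
  rw [GLog.ops, List.map_map, List.perm_middle.map _ |>.nodup_iff, List.map_cons,
    List.nodup_cons] at h
  intro g hg heq
  obtain ⟨e', he', rfl⟩ := List.mem_map.1 hg
  exact h.1 (List.mem_map.2 ⟨e', he', heq⟩)

theorem LogInv.trans (h : M.LogInv C) (ht : M.Trans stepGuard pushGuard i a C C') :
    M.LogInv C' := by
  cases ht with
  | step _ _ t hguard hlocal =>
    generalize ht₀ : C.thr i = t₀ at hlocal
    have hok := ht₀ ▸ h.ok i
    cases hlocal with
    | app c₁ c₂ m σ₁ σ₂ id L hstep hallow hfresh =>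
      have hfr : ∀ j, ∀ o' ∈ (C.thr j).log.own, o'.id ≠ id := fun j o' ho' =>
        hfresh.1 j o' (LLog.mem_ops_of_mem_own ho')
      refine h.setThr (fun o ho => ?_) (hok.app (fun o' ho' => ?_) hfresh.2) (fun o ho => ?_)
      · rw [ht₀] at ho
        obtain ⟨d, hd⟩ := LLog.mem_pushed.1 ho
        exact LLog.mem_pushed.2 ⟨d, List.mem_append_left _ hd⟩
      · exact hfr i o' (by rw [ht₀]; exact ho')
      · rw [LLog.own_append, List.mem_append] at ho
        rcases ho with ho | ho
        · exact Or.inl (by rw [ht₀]; exact ho)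
        · rw [LLog.own_npshd, LLog.own_nil, List.mem_singleton] at ho
          subst ho
          exact Or.inr hfr
    | unapp c₁ c₂ m σ₁ σ₂ id L =>
      refine h.setThr (fun o ho => ?_) (hok.sublist (List.sublist_append_left _ _))
        (fun o ho => Or.inl ?_)
      · rw [ht₀] at ho
        obtain ⟨d, hd⟩ := LLog.mem_pushed.1 ho
        exact LLog.mem_pushed.2 ⟨d, by simpa using hd⟩
      · rw [ht₀, LLog.own_append]
        exact List.mem_append_left _ ho
  | push _ c c' σ L₁ L₂ o hthr hlocal hguard hallow =>
    have hok := h.ok i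
    rw [hthr] at hok
    have hoG : ∀ g ∈ C.glob.ops, g.id ≠ o.id :=
      hok.unpushed o (LLog.mem_unpushed.2 ⟨c', by simp⟩)
    have hops : GLog.ops (C.glob ++ [(o, .gUCmt)]) = C.glob.ops ++ [o] := GLog.ops_append _ _
    refine h.update ?_ (fun _ => by rwa [hops]) (fun o' ho' => ?_) (hok.push hlocal)
      (fun j hj => (h.ok j).push_other fun o' ho' => ?_) (fun o' ho' => Or.inl ?_)
    · rw [hops, List.map_append, List.nodup_append]
      refine ⟨h.nodup, by simp, ?_⟩
      rintro _ ha _ hb rfl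
      obtain ⟨g, hg, rfl⟩ := List.mem_map.1 ha
      exact hoG g hg (by simpa using hb)
    · rw [GLog.uncommitted_append, List.mem_append] at ho'
      rcases ho' with ho' | ho'
      · by_cases hi : o' ∈ (C.thr i).log.pushed
        · rw [hthr] at hi
          obtain ⟨d, hd⟩ := LLog.mem_pushed.1 hi
          refine Or.inl (LLog.mem_pushed.2 ⟨d, ?_⟩)
          simp only [List.mem_append, List.mem_cons, Prod.mk.injEq, reduceCtorEq, and_false,
            false_or] at hd ⊢
          tauto
        · exact Or.inr ⟨ho', hi⟩
      · have : o' = o := by simpa [GLog.uncommitted] using ho'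
        subst this
        exact Or.inl (LLog.mem_pushed.2 ⟨c', by simp⟩)
    · exact h.disjoint j i hj o' ho' o (by simp [hthr, LLog.own_append, LLog.own_npshd])
    · rw [hthr]
      simpa [LLog.own_append, LLog.own_pshd, LLog.own_npshd] using ho'
  | unpush _ c c' σ L₁ L₂ G₁ G₂ o hthr hglob hlocal hallow =>
    have hok := h.ok i
    have hnodup := h.nodup
    rw [hglob] at hnodup
    rw [hthr, hglob] at hok
    have hoG := ne_of_nodup_ids hnodup
    have hsub : List.Sublist (G₁ ++ G₂) (G₁ ++ (o, .gUCmt) :: G₂) :=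
      (List.Sublist.refl G₁).append (List.sublist_cons_self _ G₂)
    refine h.update (hnodup.sublist ((hsub.map _).map _)) (fun _ => hallow) (fun o' ho' => ?_)
      (hok.unpush hoG hlocal) (fun j hj => ?_) (fun o' ho' => Or.inl ?_)
    · by_cases hi : o' ∈ (C.thr i).log.pushed
      · have hne : o' ≠ o := by
          rintro rfl
          exact hoG o' (GLog.mem_ops.2 (Or.inr ho')) rfl
        rw [hthr] at hi
        obtain ⟨d, hd⟩ := LLog.mem_pushed.1 hi
        exact Or.inl (LLog.mem_pushed.2 ⟨d, by simpa [hne] using hd⟩)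
      · refine Or.inr ⟨?_, hi⟩
        rw [hglob]
        exact (hsub.filterMap _).subset ho'
    · have hokj := h.ok j
      rw [hglob] at hokj
      refine hokj.unpush_other fun o' ho' => ?_
      exact h.disjoint j i hj o' ho' o (by simp [hthr, LLog.own_append, LLog.own_pshd])
    · rw [hthr]
      simpa [LLog.own_append, LLog.own_pshd, LLog.own_npshd] using ho'
  | pull _ c σ L o hthr =>
    have hok := h.ok i
    rw [hthr] at hok
    refine h.setThr (fun o' ho' => ?_) (hok.pull o) (fun o' ho' => Or.inl ?_)
    · rw [hthr] at ho'
      obtain ⟨d, hd⟩ := LLog.mem_pushed.1 ho'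
      exact LLog.mem_pushed.2 ⟨d, List.mem_append_left _ hd⟩
    · rw [hthr]
      simpa [LLog.own_append, LLog.own_pld, LLog.own_nil] using ho'
  | unpull _ c σ L₁ L₂ o hthr =>
    have hok := h.ok i
    rw [hthr] at hok
    refine h.setThr (fun o' ho' => ?_)
      (hok.sublist ((List.Sublist.refl L₁).append (List.sublist_cons_self _ L₂)))
      (fun o' ho' => Or.inl ?_)
    · rw [hthr] at ho'
      obtain ⟨d, hd⟩ := LLog.mem_pushed.1 ho'
      exact LLog.mem_pushed.2 ⟨d, by simpa using hd⟩
    · rw [hthr]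
      simpa [LLog.own_append, LLog.own_pld] using ho'
  | cmt _ c σ L hthr hfin hpushed hpulled =>
    refine h.update (by rw [GLog.ops_commit]; exact h.nodup)
      (by rw [GLog.ops_commit]; exact h.allow) (fun o ho => Or.inr ?_) (.nil _)
      (fun j hj => (h.ok j).commit_other fun o ho hoL => ?_) (by simp [LLog.own_nil])
    · rw [GLog.mem_uncommitted_commit] at ho
      refine ⟨ho.1, fun hi => ho.2 ?_⟩
      rw [hthr] at hi
      exact LLog.mem_own_of_pushed hi
    · exact h.disjoint j i hj o ho o (by rw [hthr]; exact hoL) rfl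

/-- Push only appends and Unpush only deletes, so nothing new gets in front of a committed
operation. Hence the mover conditions of `SimInv` persist outside commits. -/
theorem Trans.glob_of_ne_cmt (h : M.LogInv C) (ht : M.Trans stepGuard pushGuard i a C C')
    (ha : a ≠ .cmt) : C'.glob.committed = C.glob.committed ∧
      ∀ x y, List.Sublist [x, y] C'.glob.ops → y ∈ C.glob.committed →
        List.Sublist [x, y] C.glob.ops ∧ (x ∈ C'.glob.uncommitted → x ∈ C.glob.uncommitted) := by
  cases ht with
  | step => exact ⟨rfl, fun x y hxy _ => ⟨hxy, id⟩⟩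
  | push _ c c' σ L₁ L₂ o hthr =>
    have hok := h.ok i
    rw [hthr] at hok
    have hoG : o ∉ C.glob.ops := fun ho =>
      hok.unpushed o (LLog.mem_unpushed.2 ⟨c', by simp⟩) o ho rfl
    refine ⟨by simp [GLog.committed], fun x y hxy hy => ?_⟩
    have hyG := GLog.mem_ops.2 (Or.inl hy)
    rw [GLog.ops_append, pair_sublist_append] at hxy
    have hxy' : List.Sublist [x, y] C.glob.ops := by
      rcases hxy with hxy | ⟨-, hxy⟩ | hxy
      · exact hxy
      · have : y = o := by simpa [GLog.ops] using hxy
        exact absurd (this ▸ hyG) hoG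
      · simpa [GLog.ops] using hxy.length_le
    refine ⟨hxy', fun hx => ?_⟩
    rw [GLog.uncommitted_append, List.mem_append] at hx
    rcases hx with hx | hx
    · exact hx
    · have : x = o := by simpa [GLog.uncommitted] using hx
      exact absurd (this ▸ hxy'.subset (by simp)) hoG
  | unpush _ c c' σ L₁ L₂ G₁ G₂ o hthr hglob =>
    have hsub : List.Sublist (G₁ ++ G₂) (G₁ ++ (o, .gUCmt) :: G₂) :=
      (List.Sublist.refl G₁).append (List.sublist_cons_self _ G₂)
    rw [hglob]
    exact ⟨by simp [GLog.committed],
      fun x y hxy _ => ⟨hxy.trans (hsub.map _), fun hx => (hsub.filterMap _).subset hx⟩⟩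
  | pull => exact ⟨rfl, fun x y hxy _ => ⟨hxy, id⟩⟩
  | unpull => exact ⟨rfl, fun x y hxy _ => ⟨hxy, id⟩⟩
  | cmt => exact absurd rfl ha

variable (M) in
/-- The invariant of the programs of the validator: a thread with own operations is running, and
its `hb`-predecessors have finished. -/
structure ThreadInv (c : Fin N → Code) (σ : Fin N → Stack) (hb : Fin N → Fin N → Prop)
    (C : Config N Code Method Stack Id) : Prop where
  runs : M.Runs c σ C
  idle : ∀ i, (C.thr i).prog = .skip → (C.thr i).log.own = []
  guard : ∀ i j, (C.thr i).log.own ≠ [] → hb j i → (C.thr j).prog = .skip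

variable {c : Fin N → Code} {σ : Fin N → Stack} {hb : Fin N → Fin N → Prop}

theorem ThreadInv.init :
    M.ThreadInv c σ hb (Config.init c σ : Config N Code Method Stack Id) where
  runs := .init c σ
  idle := by simp [Config.init]
  guard := by simp [Config.init, LLog.own]

theorem ThreadInv.trans (h : M.ThreadInv c σ hb C)
    (ht : M.Trans (fun C i => ∀ j, hb j i → (C.thr j).prog = .skip) pushGuard i a C C') :
    M.ThreadInv c σ hb C' := by
  obtain ⟨hne, c₁, hc₁, hi⟩ := ht.thread
  have hskip : ∀ j, (C.thr j).prog = .skip → (C'.thr j).prog = .skip := by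
    intro j hj
    have hji : j ≠ i := by
      rintro rfl
      rw [hc₁] at hj
      cases hj
    rwa [hne j hji]
  refine ⟨h.runs.trans ht, fun j hj => ?_, fun j k hj hkj => hskip k ?_⟩
  · by_cases hji : j = i
    · subst hji
      rcases hi with ⟨c₂, o, -, -, -, -, hprog, -⟩ | ⟨c₂, o, -, hprog, -⟩ | ⟨-, hprog, -⟩ |
        ⟨-, -, -, -, hown⟩
      · rw [hprog] at hj; cases hj
      · rw [hprog] at hj; cases hj
      · rw [hprog] at hj; cases hj
      · rw [LLog.own_eq, hown, List.map_nil]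
    · rw [hne j hji] at hj ⊢
      exact h.idle j hj
  · by_cases hji : j = i
    · subst hji
      have hold := h.guard j k
      rw [LLog.own_eq] at hj hold
      rcases hi with ⟨c₂, o, -, hguard, -⟩ | ⟨c₂, o, -, -, -, hown⟩ | ⟨-, -, -, hown⟩ |
        ⟨-, -, -, -, hown⟩
      -- Only a forward step can create the first own operation, and its guard is the claim.
      · exact hguard k hkj
      · exact hold (by simp [hown]) hkj
      · exact hold (by rwa [hown] at hj) hkj
      · simp [hown] at hj
    · rw [hne j hji] at hj
      exact h.guard j k hj hkj

/-- If the threads were related, the predecessor would have finished and would have no own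
operations left. -/
theorem ThreadInv.mover (h : M.ThreadInv c σ hb C) (hcomm : M.UnrelatedCommute c hb)
    {i j : Fin N} (hij : i ≠ j) {x y : Op Method Stack Id} (hx : x ∈ (C.thr i).log.own)
    (hy : y ∈ (C.thr j).log.own) : M.Mover x y := by
  have hrun : ∀ k, ∀ o ∈ (C.thr k).log.own, (C.thr k).prog ≠ .skip := fun k o ho hk => by
    rw [h.idle k hk] at ho
    cases ho
  have hcalls : ∀ k, ∀ o ∈ (C.thr k).log.own, M.Calls (c k) o.meth := by
    intro k o ho
    cases hk : (C.thr k).prog with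
    | tx c' => exact h.runs.calls hk ho
    | skip => exact absurd hk (hrun k o ho)
  refine (hcomm i j hij (fun hh => ?_) (fun hh => ?_) _ _ (hcalls i x hx) (hcalls j y hy)
    x y rfl rfl).1
  · exact hrun i x hx (h.guard j i (List.ne_nil_of_mem hy) hh)
  · exact hrun j y hy (h.guard i j (List.ne_nil_of_mem hx) hh)

variable (M) in
/-- The simulation relation between validator and atomic configurations. -/
structure SimInv (c : Fin N → Code) (σ : Fin N → Stack) (hb : Fin N → Fin N → Prop)
    (C : Config N Code Method Stack Id) (A : AConfig N Code Method Stack Id) : Prop where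
  threads : M.ThreadInv c σ hb C
  logs : M.LogInv C
  perm : C.glob.committed.Perm A.log
  committed_movers : ∀ x y, List.Sublist [x, y] C.glob.ops → List.Sublist [y, x] A.log →
    M.Mover x y
  uncommitted_movers : ∀ x y, List.Sublist [x, y] C.glob.ops → x ∈ C.glob.uncommitted →
    y ∈ C.glob.committed → M.Mover x y
  atomic : ∀ i, ((C.thr i).prog = .skip → A.thr i = (.skip, (C.thr i).stack)) ∧
    ((C.thr i).prog ≠ .skip → A.thr i = (.tx (c i), σ i))

theorem SimInv.init : M.SimInv c σ hb (Config.init c σ : Config N Code Method Stack Id)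
    (AConfig.init c σ) where
  threads := .init
  logs := .init c σ
  perm := by simp [Config.init, AConfig.init, GLog.committed]
  committed_movers x y h := by simp [Config.init, GLog.ops] at h
  uncommitted_movers x y h := by simp [Config.init, GLog.ops] at h
  atomic := by simp [Config.init, AConfig.init]

variable {A : AConfig N Code Method Stack Id}

theorem SimInv.agree (h : M.SimInv c σ hb C A) : M.Agree c σ C A := by
  refine ⟨?_, h.atomic⟩
  have hnodup : C.glob.committed.Nodup :=
    (List.Nodup.of_map _ h.logs.nodup).sublist C.glob.committed_sublist
  simpa using logLe_of_inversions h.perm (h.perm.nodup_iff.1 hnodup)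
    (fun x y hxy => h.committed_movers x y (hxy.trans C.glob.committed_sublist)) []

/-- The shared log is below the atomic log, followed by the uncommitted operations. -/
theorem SimInv.logLe (h : M.SimInv c σ hb C A) :
    M.LogLe C.glob.ops (A.log ++ C.glob.uncommitted) := by
  have hnodup : C.glob.ops.Nodup := List.Nodup.of_map _ h.logs.nodup
  have hperm : C.glob.ops.Perm (A.log ++ C.glob.uncommitted) :=
    C.glob.committed_perm_uncommitted.trans (h.perm.append_right _)
  suffices hmov : ∀ x y, List.Sublist [x, y] C.glob.ops →
      List.Sublist [y, x] (A.log ++ C.glob.uncommitted) → M.Mover x y by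
    simpa using logLe_of_inversions hperm (hperm.nodup_iff.1 hnodup) hmov []
  intro x y hxy hyx
  rcases pair_sublist_append.1 hyx with hyx | ⟨hy, hx⟩ | hyx
  · exact h.committed_movers x y hxy hyx
  · exact h.uncommitted_movers x y hxy hx (h.perm.mem_iff.2 hy)
  -- The uncommitted operations keep their order from the shared log, so there is no inversion among
  -- them.
  · exact absurd (hyx.trans C.glob.uncommitted_sublist) (not_pair_sublist_swap hnodup hxy)

theorem SimInv.trans_of_ne_cmt (h : M.SimInv c σ hb C A)
    (ht : M.Trans (fun C i => ∀ j, hb j i → (C.thr j).prog = .skip) pushGuard i a C C')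
    (ha : a ≠ .cmt) : M.SimInv c σ hb C' A := by
  obtain ⟨hcom, hsub⟩ := ht.glob_of_ne_cmt h.logs ha
  refine ⟨h.threads.trans ht, h.logs.trans ht, hcom ▸ h.perm, fun x y hxy hyx => ?_,
    fun x y hxy hx hy => ?_, fun j => ?_⟩
  · exact h.committed_movers x y
      (hsub x y hxy (h.perm.mem_iff.2 (hyx.subset (by simp)))).1 hyx
  · rw [hcom] at hy
    obtain ⟨h₁, h₂⟩ := hsub x y hxy hy
    exact h.uncommitted_movers x y h₁ (h₂ hx) hy
  · obtain ⟨hne, c₁, hc₁, hi⟩ := ht.thread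
    by_cases hji : j = i
    · subst hji
      have hprog : (C'.thr j).prog ≠ .skip := by
        rcases hi with ⟨c₂, o, -, -, -, -, hprog, -⟩ | ⟨c₂, o, -, hprog, -⟩ | ⟨-, hprog, -⟩ |
          ⟨ha', -⟩
        · simp [hprog]
        · simp [hprog]
        · simp [hprog]
        · exact absurd ha' ha
      exact ⟨fun h' => absurd h' hprog, fun _ => (h.atomic j).2 (by simp [hc₁])⟩
    · rw [hne j hji]
      exact h.atomic j

/-- Since commit leaves the order of the shared log unchanged, only the inversions caused by
appending the own operations to the atomic log, and the uncommitted operations in front of newly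
committed ones, have to be checked. -/
theorem SimInv.commit (hcomm : M.UnrelatedCommute c hb) (h : M.SimInv c σ hb C A)
    (hinv : M.ThreadInv c σ hb
      ⟨Function.update C.thr i ⟨.skip, (C.thr i).stack, []⟩, C.glob.commit (C.thr i).log.own⟩)
    (hlog : M.LogInv
      ⟨Function.update C.thr i ⟨.skip, (C.thr i).stack, []⟩, C.glob.commit (C.thr i).log.own⟩)
    (hpushed : (C.thr i).log.unpushed = []) :
    M.SimInv c σ hb
      ⟨Function.update C.thr i ⟨.skip, (C.thr i).stack, []⟩, C.glob.commit (C.thr i).log.own⟩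
      ⟨Function.update A.thr i (.skip, (C.thr i).stack), A.log ++ (C.thr i).log.own⟩ := by
  have hnodup : C.glob.ops.Nodup := List.Nodup.of_map _ h.logs.nodup
  have hunc : ∀ o ∈ (C.thr i).log.own, o ∈ C.glob.uncommitted := by
    intro o ho
    rcases LLog.mem_own.1 ho with ⟨d, hd⟩ | hd
    · have := LLog.mem_unpushed.2 ⟨d, hd⟩
      simp [hpushed] at this
    · exact (h.logs.ok i).pushed o (LLog.mem_pushed.2 hd)
  have hdisj : ∀ o ∈ C.glob.committed, o ∉ C.glob.uncommitted := by
    have := C.glob.committed_perm_uncommitted.nodup_iff.1 hnodup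
    rw [List.nodup_append] at this
    exact fun o ho ho' => this.2.2 o ho o ho' rfl
  have hmem : ∀ o, o ∈ (C.glob.commit (C.thr i).log.own).committed ↔
      o ∈ C.glob.committed ∨ o ∈ (C.thr i).log.own := fun o => by
    rw [GLog.mem_committed_commit]
    exact or_congr_right ⟨And.left, fun ho => ⟨ho, hunc o ho⟩⟩
  refine ⟨hinv, hlog, ?_, ?_, ?_, fun j => ?_⟩
  · have hnodup' : (C.glob.commit (C.thr i).log.own).committed.Nodup :=
      (List.Nodup.of_map _ hlog.nodup).sublist (GLog.committed_sublist _)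
    have hA : (A.log ++ (C.thr i).log.own).Nodup := by
      refine List.nodup_append.2 ⟨h.perm.nodup_iff.1 (hnodup.sublist C.glob.committed_sublist),
        List.Nodup.of_map _ (h.logs.ok i).nodup, ?_⟩
      rintro o ho _ ho' rfl
      exact hdisj o (h.perm.mem_iff.2 ho) (hunc o ho')
    refine (List.perm_ext_iff_of_nodup hnodup' hA).2 fun o => ?_
    rw [hmem, List.mem_append, h.perm.mem_iff]
  · intro x y hxy hyx
    simp only [GLog.ops_commit] at hxy
    rcases pair_sublist_append.1 hyx with hyx | ⟨hy, hx⟩ | hyx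
    · exact h.committed_movers x y hxy hyx
    -- `x` is being committed behind `y` although it precedes `y` in the shared log; `x` was
    -- uncommitted until now.
    · exact h.uncommitted_movers x y hxy (hunc x hx) (h.perm.mem_iff.2 hy)
    · exact (h.logs.ok i).mover_of_sublist hpushed hyx hxy
  · intro x y hxy hx hy
    simp only [GLog.ops_commit] at hxy
    rw [GLog.mem_uncommitted_commit] at hx
    rcases (hmem y).1 hy with hy | hy
    · exact h.uncommitted_movers x y hxy hx.1 hy
    -- `x` stays uncommitted, so it belongs to another running thread, and commutation of unrelated
    -- transactions applies.
    · obtain ⟨j, hj⟩ := h.logs.uncommitted x hx.1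
      have hji : j ≠ i := by
        rintro rfl
        exact hx.2 (LLog.mem_own_of_pushed hj)
      exact h.threads.mover hcomm hji (LLog.mem_own_of_pushed hj) hy
  · by_cases hji : j = i
    · subst hji
      simp
    · simpa [Function.update_of_ne hji] using h.atomic j

theorem SimInv.validatorStep (hprefix : M.PrefixClosed) (hcomm : M.UnrelatedCommute c hb)
    (h : M.SimInv c σ hb C A) (ht : M.ValidatorStep hb C C') :
    ∃ A', Relation.ReflTransGen M.AtomicStep A A' ∧ M.SimInv c σ hb C' A' := by
  obtain ⟨i, a, ht⟩ := ht
  by_cases ha : a = .cmt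
  · subst ha
    have hinv := h.threads.trans ht
    have hlog := h.logs.trans ht
    cases ht with
    | step _ _ t hguard hlocal => cases hlocal
    | cmt _ c₁ σ₁ L hthr hfin hpushed =>
      have hstack : σ₁ = (C.thr i).stack := by rw [hthr]
      have hL : L = (C.thr i).log := by rw [hthr]
      have hprog : (C.thr i).prog = .tx c₁ := by rw [hthr]
      clear hthr
      subst hstack hL
      have hsim := h.commit hcomm hinv hlog hpushed
      -- The atomic machine replays the own operations with the same identifiers, from the initial
      -- code and local state.
      refine ⟨_, .single ⟨i, c i, σ i, _, _, (h.atomic i).2 (by simp [hprog]), ?_, rfl⟩, hsim⟩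
      have hrun := h.threads.runs i c₁ hprog
      -- Taken after the commit, so the own operations are already part of the atomic log and the
      -- uncommitted rest can be cut off as a suffix.
      have hle := hsim.logLe
      rw [GLog.ops_commit] at hle
      have hids := (hsim.perm.symm.map Op.id).nodup_iff.2
        (hlog.nodup.sublist ((GLog.committed_sublist _).map _))
      rw [LLog.own_eq] at hle hids ⊢
      refine hrun.bigStep hprefix hfin (fun hne => ?_) hids
      have hG : C.glob.ops ≠ [] := by
        obtain ⟨o, ho⟩ := List.exists_mem_of_ne_nil _
          (show (C.thr i).log.own ≠ [] by simpa [LLog.own_eq] using hne)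
        have ho' : o ∈ (C.glob.commit (C.thr i).log.own).ops :=
          (GLog.committed_sublist _).subset
            (hsim.perm.mem_iff.2 (List.mem_append_right _ ho))
        rw [GLog.ops_commit] at ho'
        exact List.ne_nil_of_mem ho'
      exact allowed_of_append hprefix (by simpa using hle [] (by simpa using h.logs.allow hG))
  · exact ⟨A, .refl, h.trans_of_ne_cmt ht ha⟩

end Simulation

end Model

end PushPull

theorem mainTheorem2 {Code Method Stack Id Lock : Type*}
    (M : PushPull.Model Code Method Stack Id Lock)
    (hprefix : M.PrefixClosed) (hdet : M.Deterministic) (hboost : M.BoostingRule)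
    (N : ℕ) (c : Fin N → Code) (σ : Fin N → Stack)
    (hb : Fin N → Fin N → Prop) (hhb : M.MinerEmits c σ hb) :
    PushPull.Simulates (M.ValidatorStep hb) M.AtomicStep (M.Agree c σ)
      (PushPull.Config.init c σ) (PushPull.AConfig.init c σ) :=
  ⟨M.SimInv c σ hb, .init, fun _ _ h => h.agree, fun _ _ _ h ht =>
    h.validatorStep hprefix (hhb.unrelatedCommute hdet hboost) ht⟩
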